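/- All manifolds are smooth, finite-dimensional and without boundary. Let $p,q\ge 1$ be integers. A locally metallic Riemannian manifold $(\overline M,\overline g,J)$ is a Riemannian manifold with a smooth $(1,1)$-tensor field $J$ such that $J^2=pJ+qI$, $\overline g(JX,Y)=\overline g(X,JY)$ for all vector fields $X,Y$, and $\overline\nabla J=0$ for the Levi-Civita connection $\overline\nabla$ of $\overline g$; for $p=q=1$ it is called locally Golden. A submanifold $S$ immersed in $\overline M$ is invariant if $J(T_xS)\subseteq T_xS$ for all $x\in S$, and it is slant with slant angle $\theta$ if for every $x\in S$ and every nonzero $X\in T_xS$ the angle between $JX$ and the subspace $T_xS$ is $\theta$. Theorem. Let $(\overline M,\overline g,J)$ be a locally metallic (in particular, possibly locally Golden) Riemannian manifold. Let $(M_T,g_T)$ and $(M_\theta,g_\theta)$ be Riemannian manifolds of positive dimension, with $M_\theta$ non-empty, let $f:M_T\to(0,\infty)$ be smooth, and let $M=M_T\times_f M_\theta$ be their warped product, i.e. $M_T\times M_\theta$ with the metric $g=\pi_1^*g_T+(f\circ\pi_1)^2\,\pi_2^*g_\theta$, where $\pi_1,\pi_2$ are the projections of $M_T\times M_\theta$ onto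 its factors. Let $\varphi:M\to\overline M$ be an isometric immersion and let $\theta\in(0,\pi/2)$. Suppose that $M$ is a warped product semi-slant submanifold of $\overline M$, with $M_T$ invariant and $M_\theta$ proper slant with slant angle $\theta$: for every $y\in M_\theta$ the leaf $M_T\times\{y\}$, immersed by $\varphi$, is an invariant submanifold of $\overline M$, and for every $x\in M_T$ the leaf $\{x\}\times M_\theta$, immersed by $\varphi$, is a slant submanifold of $\overline M$ with slant angle $\theta$. Then the warped product is not proper: the warping function $f$ is constant on each connected component of $M_T$. -/

import Mathlib

open Bundle
open scoped Manifold ContDiff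

noncomputable section

/-! ### Metallic and locally metallic Riemannian manifolds

A `(1,1)`-tensor field on a manifold is a family `J` of endomorphisms of the tangent spaces. -/

/-- A smooth Riemannian metric on the `m`-dimensional manifold `N`. -/
abbrev SmoothMetric (m : ℕ) (N : Type*) [TopologicalSpace N]
    [ChartedSpace (EuclideanSpace ℝ (Fin m)) N] [IsManifold (𝓡 m) ∞ N] :=
  ContMDiffRiemannianMetric (𝓡 m) ∞ (EuclideanSpace ℝ (Fin m))
    (fun x : N ↦ TangentSpace (𝓡 m) x)

section Metallic

variable {m : ℕ} {N : Type*} [TopologicalSpace N] [ChartedSpace (EuclideanSpace ℝ (Fin m)) N]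
  [IsManifold (𝓡 m) ∞ N]

/-- The norm of a tangent vector with respect to the metric `g`. -/
def metricNorm (g : SmoothMetric m N) (x : N) (u : TangentSpace (𝓡 m) x) : ℝ :=
  Real.sqrt (g.inner x u u)

/-- The angle between two tangent vectors with respect to the metric `g` (`π / 2` if one of them
is zero). -/
def metricAngle (g : SmoothMetric m N) (x : N) (u v : TangentSpace (𝓡 m) x) : ℝ :=
  Real.arccos (g.inner x u v / (metricNorm g x u * metricNorm g x v))

/-- `(N, g, J)` is a metallic Riemannian manifold with parameters `p, q ∈ ℕ*`: `J` is a smooth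
`(1,1)`-tensor field with `J² = p J + q I`, and the metric is `J`-compatible. -/
structure IsMetallicRiemannian (g : SmoothMetric m N) (p q : ℕ)
    (J : ∀ x : N, TangentSpace (𝓡 m) x →L[ℝ] TangentSpace (𝓡 m) x) : Prop where
  p_pos : 0 < p
  q_pos : 0 < q
  contMDiff : ContMDiff (𝓡 m)
    ((𝓡 m).prod 𝓘(ℝ, EuclideanSpace ℝ (Fin m) →L[ℝ] EuclideanSpace ℝ (Fin m))) ∞
    (fun x ↦ TotalSpace.mk' (EuclideanSpace ℝ (Fin m) →L[ℝ] EuclideanSpace ℝ (Fin m))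
      (E := fun x : N ↦ TangentSpace (𝓡 m) x →L[ℝ] TangentSpace (𝓡 m) x) x (J x))
  sq : ∀ (x : N) (v : TangentSpace (𝓡 m) x), J x (J x v) = (p : ℝ) • J x v + (q : ℝ) • v
  compatible : ∀ (x : N) (v w : TangentSpace (𝓡 m) x),
    g.inner x (J x v) w = g.inner x v (J x w)

/-- The vector field `Y` is differentiable at the point `x`. -/
def FieldDifferentiableAt (Y : ∀ x : N, TangentSpace (𝓡 m) x) (x : N) : Prop :=
  MDifferentiableAt (𝓡 m) ((𝓡 m).prod 𝓘(ℝ, EuclideanSpace ℝ (Fin m)))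
    (fun y ↦ TotalSpace.mk' (EuclideanSpace ℝ (Fin m))
      (E := fun x : N ↦ TangentSpace (𝓡 m) x) y (Y y)) x

/-- An affine connection is the Levi-Civita connection of `g` if it is torsion-free and
`X g(Y, Z) = g(∇_X Y, Z) + g(Y, ∇_X Z)`; these two properties determine it. (In Mathlib's argument
order `nabla Y x v` is the covariant derivative of `Y` at `x` along `v`.) -/
structure IsLeviCivita (g : SmoothMetric m N)
    (nabla : CovariantDerivative (𝓡 m) (EuclideanSpace ℝ (Fin m))
      (fun x : N ↦ TangentSpace (𝓡 m) x)) : Prop where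
  torsion_free : nabla.torsion = 0
  metric : ∀ (Y Z : ∀ x : N, TangentSpace (𝓡 m) x) (x : N),
    FieldDifferentiableAt Y x → FieldDifferentiableAt Z x → ∀ v : TangentSpace (𝓡 m) x,
      mfderiv (𝓡 m) 𝓘(ℝ, ℝ) (fun y ↦ g.inner y (Y y) (Z y)) x v =
        g.inner x (nabla Y x v) (Z x) + g.inner x (Y x) (nabla Z x v)

/-- `J` is parallel with respect to `nabla`: `∇_X (J Y) = J (∇_X Y)`, that is `∇ J = 0`. -/
def IsParallelTensor
    (nabla : CovariantDerivative (𝓡 m) (EuclideanSpace ℝ (Fin m))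
      (fun x : N ↦ TangentSpace (𝓡 m) x))
    (J : ∀ x : N, TangentSpace (𝓡 m) x →L[ℝ] TangentSpace (𝓡 m) x) : Prop :=
  ∀ (Y : ∀ x : N, TangentSpace (𝓡 m) x) (x : N), FieldDifferentiableAt Y x →
    ∀ v : TangentSpace (𝓡 m) x, nabla (fun y ↦ J y (Y y)) x v = J x (nabla Y x v)

/-- `(N, g, J)` is a locally metallic Riemannian manifold: a metallic Riemannian manifold whose
structure `J` is parallel with respect to the Levi-Civita connection. For `p = q = 1` this is a
locally Golden Riemannian manifold. -/
def IsLocallyMetallicRiemannian (g : SmoothMetric m N) (p q : ℕ)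
    (J : ∀ x : N, TangentSpace (𝓡 m) x →L[ℝ] TangentSpace (𝓡 m) x) : Prop :=
  IsMetallicRiemannian g p q J ∧
    ∃ nabla : CovariantDerivative (𝓡 m) (EuclideanSpace ℝ (Fin m))
      (fun x : N ↦ TangentSpace (𝓡 m) x), IsLeviCivita g nabla ∧ IsParallelTensor nabla J

end Metallic

/-! ### Pulled back metrics, invariant and slant immersed submanifolds -/

section Submanifold

variable {E : Type*} [NormedAddCommGroup E] [NormedSpace ℝ E] {H : Type*} [TopologicalSpace H]
  {S : Type*} [TopologicalSpace S] [ChartedSpace H S]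
  {m : ℕ} {N : Type*} [TopologicalSpace N] [ChartedSpace (EuclideanSpace ℝ (Fin m)) N]
  [IsManifold (𝓡 m) ∞ N]

/-- The pullback `φ^* g` of the metric `g` of `N` along `φ : S → N`. -/
def pullbackMetric (I : ModelWithCorners ℝ E H) (g : SmoothMetric m N) (φ : S → N) (s : S)
    (v w : TangentSpace I s) : ℝ :=
  g.inner (φ s) (mfderiv I (𝓡 m) φ s v) (mfderiv I (𝓡 m) φ s w)

/-- The image `φ_* (T_s S)` of the tangent space of `S` at `s`, a subspace of `T_{φ s} N`. -/
def tangentImage (I : ModelWithCorners ℝ E H) (φ : S → N) (s : S) :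
    Submodule ℝ (TangentSpace (𝓡 m) (φ s)) :=
  LinearMap.range (mfderiv I (𝓡 m) φ s).toLinearMap

/-- `t` is the tangential part of `u ∈ T_{φ s} N`: the vector of `φ_* (T_s S)` for which `u - t`
is normal to `φ_* (T_s S)`. -/
def IsTangentialPart (I : ModelWithCorners ℝ E H) (g : SmoothMetric m N) (φ : S → N) (s : S)
    (u t : TangentSpace (𝓡 m) (φ s)) : Prop :=
  t ∈ tangentImage I φ s ∧ ∀ w ∈ tangentImage I φ s, g.inner (φ s) (u - t) w = 0

/-- `S`, immersed by `φ`, is an invariant submanifold: `J` maps each tangent space of `S` to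
itself. -/
def IsInvariantSubmanifold (I : ModelWithCorners ℝ E H)
    (J : ∀ x : N, TangentSpace (𝓡 m) x →L[ℝ] TangentSpace (𝓡 m) x) (φ : S → N) : Prop :=
  ∀ s : S, ∀ u ∈ tangentImage I φ s, J (φ s) u ∈ tangentImage I φ s

/-- `S`, immersed by `φ`, is a slant submanifold with slant angle `θ`: for each nonzero tangent
vector `u` of `S`, the angle between `J u` and the tangent space of `S`, i.e. the angle between
`J u` and its tangential part, is `θ` (`π / 2` when the tangential part is zero). -/
def IsSlantSubmanifold (I : ModelWithCorners ℝ E H) (g : SmoothMetric m N)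
    (J : ∀ x : N, TangentSpace (𝓡 m) x →L[ℝ] TangentSpace (𝓡 m) x) (φ : S → N) (θ : ℝ) : Prop :=
  ∀ s : S, ∀ u ∈ tangentImage I φ s, u ≠ 0 →
    ∃ t, IsTangentialPart I g φ s (J (φ s) u) t ∧ metricAngle g (φ s) (J (φ s) u) t = θ

end Submanifold

/-! ### Warped products -/

section Warped

variable {n₁ n₂ m : ℕ}
  {M₁ : Type*} [TopologicalSpace M₁] [ChartedSpace (EuclideanSpace ℝ (Fin n₁)) M₁]
  [IsManifold (𝓡 n₁) ∞ M₁]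
  {M₂ : Type*} [TopologicalSpace M₂] [ChartedSpace (EuclideanSpace ℝ (Fin n₂)) M₂]
  [IsManifold (𝓡 n₂) ∞ M₂]
  {N : Type*} [TopologicalSpace N] [ChartedSpace (EuclideanSpace ℝ (Fin m)) N]
  [IsManifold (𝓡 m) ∞ N]

/-- The warped product metric `π₁^* g₁ + (f ∘ π₁)² π₂^* g₂` on `M₁ × M₂`. -/
def warpedMetric (g₁ : SmoothMetric n₁ M₁) (g₂ : SmoothMetric n₂ M₂) (f : M₁ → ℝ) (z : M₁ × M₂)
    (v w : TangentSpace ((𝓡 n₁).prod (𝓡 n₂)) z) : ℝ :=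
  pullbackMetric ((𝓡 n₁).prod (𝓡 n₂)) g₁ (Prod.fst : M₁ × M₂ → M₁) z v w +
    f z.1 ^ 2 * pullbackMetric ((𝓡 n₁).prod (𝓡 n₂)) g₂ (Prod.snd : M₁ × M₂ → M₂) z v w

/-- The warped product `M₁ ×_f M₂` is an isometrically immersed submanifold of `N` by `φ`:
`f` is a smooth positive function on `M₁`, and `φ : M₁ × M₂ → N` is smooth and pulls the metric of
`N` back to the warped product metric (so that `φ` is an immersion). -/
structure IsWarpedProductSubmanifold (g₁ : SmoothMetric n₁ M₁) (g₂ : SmoothMetric n₂ M₂)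
    (g : SmoothMetric m N) (f : M₁ → ℝ) (φ : M₁ × M₂ → N) : Prop where
  contMDiff_warping : ContMDiff (𝓡 n₁) 𝓘(ℝ, ℝ) ∞ f
  warping_pos : ∀ x, 0 < f x
  contMDiff : ContMDiff ((𝓡 n₁).prod (𝓡 n₂)) (𝓡 m) ∞ φ
  isometric : ∀ (z : M₁ × M₂) (v w : TangentSpace ((𝓡 n₁).prod (𝓡 n₂)) z),
    pullbackMetric ((𝓡 n₁).prod (𝓡 n₂)) g φ z v w = warpedMetric g₁ g₂ f z v w

/-- The warped product `M₁ ×_f M₂` is, by `φ`, a semi-slant submanifold of `(N, g, J)` with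
invariant base and slant fibre of slant angle `θ`. The factors, as submanifolds of `N`, are the
leaves `M₁ × {y}` and `{x} × M₂`. -/
structure IsWarpedProductSemiSlant (g₁ : SmoothMetric n₁ M₁) (g₂ : SmoothMetric n₂ M₂)
    (g : SmoothMetric m N) (J : ∀ x : N, TangentSpace (𝓡 m) x →L[ℝ] TangentSpace (𝓡 m) x)
    (f : M₁ → ℝ) (φ : M₁ × M₂ → N) (θ : ℝ) : Prop
    extends IsWarpedProductSubmanifold g₁ g₂ g f φ where
  invariant_base : ∀ y : M₂, IsInvariantSubmanifold (𝓡 n₁) J (fun x : M₁ ↦ φ (x, y))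
  slant_fibre : ∀ x : M₁, IsSlantSubmanifold (𝓡 n₂) g J (fun y : M₂ ↦ φ (x, y)) θ

end Warped

end

/-!
The warping function is constant because its differential vanishes. Fix a point `(x, y)` and write
`C` for a vector field tangent to the fibres which is constant in a chart of `M_θ`. For `X` tangent
to the base, `X' = J X` is again tangent to the base, since the base is invariant. Both are
orthogonal to `C`, as is `J C` to `X`; differentiating these relations along `C`, and using that `J`
is parallel and symmetric and that the second derivatives of the immersion are symmetric, gives
`X g(J C, C) = X' g(C, C)` (`fderiv_slant_form_eq`).

The slant condition relates the two sides. The tangential part `T` of `J` on a fibre satisfies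
`|T C|² = c |J C|² = c (p g(J C, C) + q g(C, C))`, where `c = cos² θ`; so Cauchy–Schwarz gives
`g(J C, C)² ≤ c (p g(J C, C) + q g(C, C)) g(C, C)`, with equality when `C` is an eigenvector of `T`
(`sq_slant_form_le`). Polarization gives `T² = c (p T + q)`, so that there is an eigenvector with
eigenvalue `l`, `l² = c (p l + q)` (`exists_slant_eigenvector`). If `C` is an eigenvector at the
point considered, the first-order condition for the inequality there is
`X g(J C, C) = l X g(C, C)` (`fderiv_eq_smul_of_slant`). No differentiable family of eigenvectors is
needed.

Since `g(C, C)` is a constant multiple of `f²` along the base, it follows that `df(J X) = l df(X)`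
(`exists_eigenvalue_mvfderiv_warping`). Hence `l² df(X) = df(J² X) = (p l + q) df(X)`, and
`l² = c (p l + q)` with `c < 1` and `q > 0` forces `df(X) = 0`.

The computation takes place in charts. The Levi-Civita connection enters only through its
Christoffel symbols at one point (`exists_levi_civita_christoffel`).
-/

/-! ### Covariant derivatives along a map between vector spaces -/

section Calculus
open Filter Topology

variable {P : Type*} [NormedAddCommGroup P] [NormedSpace ℝ P]
  {E : Type*} [NormedAddCommGroup E] [NormedSpace ℝ E]

set_option synthInstance.maxHeartbeats 100000 in
/-- In a vector space with a metric `G` and Christoffel symbols `Γ` compatible with it at `Φ a`, the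
product rule for `G(U, W)`, where `U`, `W` are vector fields along `Φ`. The expression
`fderiv ℝ U a v + Γ (U a) (fderiv ℝ Φ a v)` is the covariant derivative of `U` along `v`. -/
theorem fderiv_metric_along {G : E → E →L[ℝ] E →L[ℝ] ℝ} {Γ : E →L[ℝ] E →L[ℝ] E}
    {Φ U W : P → E} {a : P} (hG : DifferentiableAt ℝ G (Φ a))
    (hGΓ : ∀ v u w, fderiv ℝ G (Φ a) v u w = G (Φ a) (Γ u v) w + G (Φ a) u (Γ w v))
    (hΦ : DifferentiableAt ℝ Φ a) (hU : DifferentiableAt ℝ U a) (hW : DifferentiableAt ℝ W a)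
    (v : P) :
    fderiv ℝ (fun b ↦ G (Φ b) (U b) (W b)) a v =
      G (Φ a) (fderiv ℝ U a v + Γ (U a) (fderiv ℝ Φ a v)) (W a) +
        G (Φ a) (U a) (fderiv ℝ W a v + Γ (W a) (fderiv ℝ Φ a v)) := by
  have h1 : HasFDerivAt (fun b ↦ G (Φ b)) ((fderiv ℝ G (Φ a)).comp (fderiv ℝ Φ a)) a :=
    HasFDerivAt.comp (g := G) a hG.hasFDerivAt hΦ.hasFDerivAt
  rw [((h1.clm_apply hU.hasFDerivAt).clm_apply hW.hasFDerivAt).fderiv]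
  simp [hGΓ]
  ring

set_option synthInstance.maxHeartbeats 100000 in
theorem differentiableAt_metric_along {G : E → E →L[ℝ] E →L[ℝ] ℝ} {Φ U W : P → E} {a : P}
    (hG : DifferentiableAt ℝ G (Φ a)) (hΦ : DifferentiableAt ℝ Φ a)
    (hU : DifferentiableAt ℝ U a) (hW : DifferentiableAt ℝ W a) :
    DifferentiableAt ℝ (fun b ↦ G (Φ b) (U b) (W b)) a := by
  have h1 : HasFDerivAt (fun b ↦ G (Φ b)) ((fderiv ℝ G (Φ a)).comp (fderiv ℝ Φ a)) a :=
    HasFDerivAt.comp (g := G) a hG.hasFDerivAt hΦ.hasFDerivAt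
  exact ((h1.clm_apply hU.hasFDerivAt).clm_apply hW.hasFDerivAt).differentiableAt

/-- If `J` is parallel at `Φ a`, it commutes with the covariant derivative of vector fields along
`Φ`. -/
theorem fderiv_endomorphism_along {J : E → E →L[ℝ] E} {Γ : E →L[ℝ] E →L[ℝ] E}
    {Φ U : P → E} {a : P} (hJ : DifferentiableAt ℝ J (Φ a))
    (hJΓ : ∀ v u, fderiv ℝ J (Φ a) v u + Γ (J (Φ a) u) v = J (Φ a) (Γ u v))
    (hΦ : DifferentiableAt ℝ Φ a) (hU : DifferentiableAt ℝ U a) (v : P) :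
    fderiv ℝ (fun b ↦ J (Φ b) (U b)) a v + Γ (J (Φ a) (U a)) (fderiv ℝ Φ a v) =
      J (Φ a) (fderiv ℝ U a v + Γ (U a) (fderiv ℝ Φ a v)) := by
  have h1 : HasFDerivAt (fun b ↦ J (Φ b)) _ a := hJ.hasFDerivAt.comp a hΦ.hasFDerivAt
  rw [(h1.clm_apply hU.hasFDerivAt).fderiv, map_add, ← hJΓ]
  simp
  abel

/-- Let `J` be symmetric and parallel, and let `J ∂ₓΦ = ∂ₓ'Φ` at `a`. If `J ∂ₓΦ` and `∂ₓ'Φ` are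
orthogonal to `C = ∂_z Φ` near `a`, then the derivative of `G(J C, C)` along `x` equals that of
`G(C, C)` along `x'`. With the covariant Hessian `B v w = ∇_v ∂_w Φ`, which is symmetric,
the first is `2 G(B x z, J C)` and the second `2 G(B x' z, C)`; differentiating the two
orthogonality relations along `z` gives `G(B x z, J C) = -G(J ∂ₓΦ, B z z)` and
`G(B x' z, C) = -G(∂ₓ'Φ, B z z)`. -/
theorem fderiv_slant_form_eq {G : E → E →L[ℝ] E →L[ℝ] ℝ} {J : E → E →L[ℝ] E}
    {Γ : E →L[ℝ] E →L[ℝ] E} {Φ : P → E} {a : P} (hΦ : ContDiffAt ℝ 2 Φ a)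
    (hG : DifferentiableAt ℝ G (Φ a)) (hJ : DifferentiableAt ℝ J (Φ a))
    (hGΓ : ∀ v u w, fderiv ℝ G (Φ a) v u w = G (Φ a) (Γ u v) w + G (Φ a) u (Γ w v))
    (hJΓ : ∀ v u, fderiv ℝ J (Φ a) v u + Γ (J (Φ a) u) v = J (Φ a) (Γ u v))
    (hΓ : ∀ u v, Γ u v = Γ v u)
    (hGs : ∀ u v, G (Φ a) u v = G (Φ a) v u)
    (hGJ : ∀ u v, G (Φ a) (J (Φ a) u) v = G (Φ a) u (J (Φ a) v))
    {x x' z : P}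
    (hJx : J (Φ a) (fderiv ℝ Φ a x) = fderiv ℝ Φ a x')
    (h₁ : ∀ᶠ b in 𝓝 a, G (Φ b) (J (Φ b) (fderiv ℝ Φ b x)) (fderiv ℝ Φ b z) = 0)
    (h₂ : ∀ᶠ b in 𝓝 a, G (Φ b) (fderiv ℝ Φ b x') (fderiv ℝ Φ b z) = 0) :
    fderiv ℝ (fun b ↦ G (Φ b) (J (Φ b) (fderiv ℝ Φ b z)) (fderiv ℝ Φ b z)) a x =
      fderiv ℝ (fun b ↦ G (Φ b) (fderiv ℝ Φ b z) (fderiv ℝ Φ b z)) a x' := by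
  have hd : DifferentiableAt ℝ Φ a := hΦ.differentiableAt (by norm_num)
  have hdd : DifferentiableAt ℝ (fderiv ℝ Φ) a :=
    (hΦ.fderiv_right (m := 1) (by norm_num)).differentiableAt (by norm_num)
  have hD (w : P) : DifferentiableAt ℝ (fun b ↦ fderiv ℝ Φ b w) a :=
    hdd.clm_apply (differentiableAt_const w)
  have hJD (w : P) : DifferentiableAt ℝ (fun b ↦ J (Φ b) (fderiv ℝ Φ b w)) a :=
    (hJ.comp a hd).clm_apply (hD w)
  -- `B v w` is the covariant derivative along `v` of the field `∂_w Φ`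
  set B : P → P → E := fun v w ↦
    fderiv ℝ (fun b ↦ fderiv ℝ Φ b w) a v + Γ (fderiv ℝ Φ a w) (fderiv ℝ Φ a v) with hB
  have hsymm (v w : P) : B v w = B w v := by
    have h := (hΦ.isSymmSndFDerivAt (by simp)).eq v w
    have e (v w : P) : fderiv ℝ (fun b ↦ fderiv ℝ Φ b w) a v = fderiv ℝ (fderiv ℝ Φ) a v w := by
      rw [fderiv_clm_apply hdd (differentiableAt_const w)]
      simp
    simp only [hB, e, h, hΓ (fderiv ℝ Φ a w)]
  have hmet (v w : P) := fderiv_metric_along hG hGΓ hd (hD v) (hD w)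
  have hJmet (v w u : P) : fderiv ℝ
      (fun b ↦ G (Φ b) (J (Φ b) (fderiv ℝ Φ b v)) (fderiv ℝ Φ b w)) a u =
      G (Φ a) (B u v) (J (Φ a) (fderiv ℝ Φ a w)) +
        G (Φ a) (J (Φ a) (fderiv ℝ Φ a v)) (B u w) := by
    rw [fderiv_metric_along hG hGΓ hd (hJD v) (hD w),
      fderiv_endomorphism_along hJ hJΓ hd (hD v), hGJ]
  have e₁ := hJmet x z z
  have e₂ := hmet x' z z
  rw [(show (fun b ↦ G (Φ b) (J (Φ b) (fderiv ℝ Φ b x)) (fderiv ℝ Φ b z)) =ᶠ[𝓝 a]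
    fun _ ↦ (0 : ℝ) from h₁).fderiv_eq] at e₁
  rw [(show (fun b ↦ G (Φ b) (fderiv ℝ Φ b x') (fderiv ℝ Φ b z)) =ᶠ[𝓝 a]
    fun _ ↦ (0 : ℝ) from h₂).fderiv_eq] at e₂
  rw [hJmet z z x, hmet z z x']
  simp only [fderiv_fun_const, Pi.zero_apply, zero_apply] at e₁ e₂
  change 0 = G (Φ a) (B z x') _ + G (Φ a) _ (B z z) at e₂
  change _ = G (Φ a) (B x' z) _ + G (Φ a) _ (B x' z)
  rw [hJx] at e₁
  rw [hGs _ (B x z), hGs _ (B x' z), hsymm x z, hsymm x' z]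
  linarith

/-- The quadratic inequality `S² ≤ c (p S + q G) G` is an equality at `a`, where `S = l G`; the
first-order condition there is `dS = l dG`, because `l` is a simple root of `X² - c (p X + q)`. -/
theorem fderiv_eq_smul_of_slant {S G : P → ℝ} {a : P} {c p q l : ℝ}
    (hS : DifferentiableAt ℝ S a) (hG : DifferentiableAt ℝ G a)
    (hle : ∀ᶠ b in 𝓝 a, S b ^ 2 ≤ c * (p * S b + q * G b) * G b)
    (hSa : S a = l * G a) (hGa : 0 < G a) (hl : l ^ 2 = c * (p * l + q)) (hcq : 0 < c * q)
    (x : P) : fderiv ℝ S a x = l * fderiv ℝ G a x := by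
  -- the difference of the two sides vanishes at `a` and is non-negative near `a`
  have hmin : IsLocalMin (fun b ↦ c * (p * S b + q * G b) * G b - S b ^ 2) a := by
    filter_upwards [hle] with b hb
    have : c * (p * S a + q * G a) * G a - S a ^ 2 = 0 := by
      rw [hSa]; linear_combination (-(G a) ^ 2) * hl
    rw [this]; linarith
  have hd : HasFDerivAt (fun b ↦ c * (p * S b + q * G b) * G b - S b ^ 2) _ a :=
    ((((hS.hasFDerivAt.const_mul p).add (hG.hasFDerivAt.const_mul q)).const_mul c).mul
      hG.hasFDerivAt).sub (hS.hasFDerivAt.pow 2)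
  have h0 := congrArg (fun L ↦ L x) (hmin.hasFDerivAt_eq_zero hd)
  simp [hSa] at h0
  -- a double root `l` would satisfy `l² = -c q < 0`
  have hne : G a * (c * p - 2 * l) ≠ 0 := by
    refine mul_ne_zero hGa.ne' fun h ↦ ?_
    have : l ^ 2 + c * q = 0 := by linear_combination -hl - l * h
    nlinarith [sq_nonneg l]
  apply mul_left_cancel₀ hne
  linear_combination h0 + 2 * G a * fderiv ℝ G a x * hl

end Calculus

/-! ### Metrics, endomorphisms and connections in a chart -/

section Coordinates
open Filter Topology

variable {m : ℕ} {N : Type*} [TopologicalSpace N] [ChartedSpace (EuclideanSpace ℝ (Fin m)) N]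
  [IsManifold (𝓡 m) ∞ N]

/-- The coordinates of tangent vectors at `y` in the chart at `n`, that is the trivialization of the
tangent bundle given by this chart; zero if `y` is outside the domain of the chart. -/
noncomputable def coordMap (n y : N) : TangentSpace (𝓡 m) y →L[ℝ] EuclideanSpace ℝ (Fin m) :=
  (trivializationAt (EuclideanSpace ℝ (Fin m)) (TangentSpace (𝓡 m)) n).continuousLinearMapAt ℝ y

/-- At its centre, the chart at `n` identifies `T_n N`, which is by definition the model space, with
the model space by the identity. -/
theorem coordMap_self (n : N) (v : TangentSpace (𝓡 m) n) : coordMap n n v = v := by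
  rw [coordMap, TangentBundle.continuousLinearMapAt_trivializationAt (by simp),
    mfderiv_extChartAt_self]
  rfl

theorem mdifferentiableAt_coordMap {Y : ∀ x : N, TangentSpace (𝓡 m) x} {n : N}
    (hY : FieldDifferentiableAt Y n) :
    MDifferentiableAt (𝓡 m) 𝓘(ℝ, EuclideanSpace ℝ (Fin m)) (fun y ↦ coordMap n y (Y y)) n := by
  refine ((mdifferentiableAt_section (𝓡 m) Y).1 hY).congr_of_eventuallyEq ?_
  filter_upwards [(trivializationAt (EuclideanSpace ℝ (Fin m)) (TangentSpace (𝓡 m))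
    n).open_baseSet.mem_nhds (FiberBundle.mem_baseSet_trivializationAt' n)] with y hy
  simp only [coordMap, Trivialization.continuousLinearMapAt_apply,
    Trivialization.linearMapAt_apply, hy, if_true]

/-- The Christoffel symbols at `n` in the chart at `n`: the covariant derivative minus the
derivative of the coordinates is tensorial. In `Γ u v` the vector `u` is the value of the
differentiated field and `v` is the direction of differentiation. -/
theorem exists_christoffel
    (nabla : CovariantDerivative (𝓡 m) (EuclideanSpace ℝ (Fin m))
      (fun x : N ↦ TangentSpace (𝓡 m) x)) (n : N) :
    ∃ Γ : EuclideanSpace ℝ (Fin m) →L[ℝ] EuclideanSpace ℝ (Fin m) →L[ℝ]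
        EuclideanSpace ℝ (Fin m),
      ∀ (Y : ∀ x : N, TangentSpace (𝓡 m) x), FieldDifferentiableAt Y n →
        ∀ v : TangentSpace (𝓡 m) n, coordMap n n (nabla Y n v) =
          mvfderiv (𝓡 m) (fun y ↦ coordMap n y (Y y)) n v +
            Γ (coordMap n n (Y n)) (coordMap n n v) := by
  have hT : TensorialAt (𝓡 m) (EuclideanSpace ℝ (Fin m))
      (fun Y : ∀ x : N, TangentSpace (𝓡 m) x ↦
        (coordMap n n).comp (nabla Y n) - mvfderiv (𝓡 m) (fun y ↦ coordMap n y (Y y)) n) n := by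
    constructor
    · intro f Y hf hY
      have h1 := nabla.isCovariantDerivativeOnUniv.leibniz hY hf
      have h2 : (fun y ↦ coordMap n y ((f • Y) y)) = f • fun y ↦ coordMap n y (Y y) := by
        ext1 y; simp
      rw [h1, h2, mvfderiv_smul hf (mdifferentiableAt_coordMap hY)]
      ext1 v
      simp only [sub_apply, ContinuousLinearMap.comp_apply, add_apply, smul_apply, map_add,
        map_smul, ContinuousLinearMap.smulRight_apply]
      module
    · intro Y Z hY hZ
      have h1 := nabla.isCovariantDerivativeOnUniv.add hY hZ
      have h2 : (fun y ↦ coordMap n y ((Y + Z) y)) =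
        (fun y ↦ coordMap n y (Y y)) + fun y ↦ coordMap n y (Z y) := by
        ext1 y; simp
      rw [h1, h2, mvfderiv_add (mdifferentiableAt_coordMap hY) (mdifferentiableAt_coordMap hZ),
        ContinuousLinearMap.comp_add]
      abel
  refine ⟨TensorialAt.mkHom _ n hT, fun Y hY v ↦ ?_⟩
  have h : TensorialAt.mkHom _ n hT (Y n) v =
      coordMap n n (nabla Y n v) - mvfderiv (𝓡 m) (fun y ↦ coordMap n y (Y y)) n v := by
    rw [TensorialAt.mkHom_apply hT hY]
    rfl
  rw [coordMap_self n (Y n), coordMap_self n v]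
  exact eq_add_of_sub_eq' h.symm

/-- The Gram form of the metric `g` in the chart at `n`, as a function of the coordinates `e`; it is
meaningful for `e` in the target of the chart. -/
noncomputable def metricCoord (g : SmoothMetric m N) (n : N) (e : EuclideanSpace ℝ (Fin m)) :
    EuclideanSpace ℝ (Fin m) →L[ℝ] EuclideanSpace ℝ (Fin m) →L[ℝ] ℝ :=
  ContinuousLinearMap.inCoordinates (EuclideanSpace ℝ (Fin m)) (fun x : N ↦ TangentSpace (𝓡 m) x)
    (EuclideanSpace ℝ (Fin m) →L[ℝ] ℝ) (fun x : N ↦ TangentSpace (𝓡 m) x →L[ℝ] ℝ)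
    n ((extChartAt (𝓡 m) n).symm e) n ((extChartAt (𝓡 m) n).symm e)
    (g.inner ((extChartAt (𝓡 m) n).symm e))

/-- The endomorphism field `J` in the chart at `n`, as a function of the coordinates `e`; it is
meaningful for `e` in the target of the chart. -/
noncomputable def endCoord (J : ∀ x : N, TangentSpace (𝓡 m) x →L[ℝ] TangentSpace (𝓡 m) x) (n : N)
    (e : EuclideanSpace ℝ (Fin m)) : EuclideanSpace ℝ (Fin m) →L[ℝ] EuclideanSpace ℝ (Fin m) :=
  ContinuousLinearMap.inCoordinates (EuclideanSpace ℝ (Fin m)) (fun x : N ↦ TangentSpace (𝓡 m) x)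
    (EuclideanSpace ℝ (Fin m)) (fun x : N ↦ TangentSpace (𝓡 m) x)
    n ((extChartAt (𝓡 m) n).symm e) n ((extChartAt (𝓡 m) n).symm e)
    (J ((extChartAt (𝓡 m) n).symm e))

theorem mdifferentiableAt_extChartAt_symm' {y : N} {e : EuclideanSpace ℝ (Fin m)}
    (he : e ∈ (extChartAt (𝓡 m) y).target) :
    MDifferentiableAt 𝓘(ℝ, EuclideanSpace ℝ (Fin m)) (𝓡 m) (extChartAt (𝓡 m) y).symm e := by
  have h := mdifferentiableWithinAt_extChartAt_symm he
  rw [ModelWithCorners.range_eq_univ] at h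
  exact mdifferentiableWithinAt_univ.1 h

set_option synthInstance.maxHeartbeats 100000 in
theorem differentiableAt_metricCoord (g : SmoothMetric m N) (n : N) :
    DifferentiableAt ℝ (metricCoord g n) (extChartAt (𝓡 m) n n) := by
  have h := ((mdifferentiableAt_hom_bundle _).1
    (g.contMDiff.mdifferentiableAt (x := n) (by simp))).2
  have hd : MDifferentiableAt 𝓘(ℝ, EuclideanSpace ℝ (Fin m))
      𝓘(ℝ, EuclideanSpace ℝ (Fin m) →L[ℝ] EuclideanSpace ℝ (Fin m) →L[ℝ] ℝ)
      (metricCoord g n) (extChartAt (𝓡 m) n n) :=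
    MDifferentiableAt.comp_of_eq _ h
      (mdifferentiableAt_extChartAt_symm' (mem_extChartAt_target n)) (extChartAt_to_inv n)
  exact hd.differentiableAt

theorem differentiableAt_endCoord {J : ∀ x : N, TangentSpace (𝓡 m) x →L[ℝ] TangentSpace (𝓡 m) x}
    {g : SmoothMetric m N} {p q : ℕ} (hJ : IsMetallicRiemannian g p q J) (n : N) :
    DifferentiableAt ℝ (endCoord J n) (extChartAt (𝓡 m) n n) := by
  have h := ((mdifferentiableAt_hom_bundle _).1
    (hJ.contMDiff.mdifferentiableAt (x := n) (by simp))).2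
  refine MDifferentiableAt.differentiableAt ?_
  exact MDifferentiableAt.comp_of_eq _ h
    (mdifferentiableAt_extChartAt_symm' (mem_extChartAt_target n)) (extChartAt_to_inv n)

theorem metricCoord_coordMap (g : SmoothMetric m N) {n y : N}
    (hy : y ∈ (chartAt (EuclideanSpace ℝ (Fin m)) n).source) (v w : TangentSpace (𝓡 m) y) :
    metricCoord g n (extChartAt (𝓡 m) n y) (coordMap n y v) (coordMap n y w) = g.inner y v w := by
  have hb : y ∈ (trivializationAt (EuclideanSpace ℝ (Fin m)) (TangentSpace (𝓡 m)) n).baseSet := hy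
  have h : (extChartAt (𝓡 m) n).symm (extChartAt (𝓡 m) n y) = y :=
    (extChartAt (𝓡 m) n).left_inv (by simpa using hy)
  rw [metricCoord, h, inCoordinates_apply_eq₂ hb hb (Set.mem_univ _)]
  have hs (u : TangentSpace (𝓡 m) y) : (trivializationAt (EuclideanSpace ℝ (Fin m))
      (TangentSpace (𝓡 m)) n).symm y (coordMap n y u) = u :=
    (Trivialization.symmL_apply _ hb _).symm.trans
      (Trivialization.symmL_continuousLinearMapAt (R := ℝ) _ hb u)
  rw [hs, hs]
  simp

theorem endCoord_coordMap (J : ∀ x : N, TangentSpace (𝓡 m) x →L[ℝ] TangentSpace (𝓡 m) x)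
    {n y : N}
    (hy : y ∈ (chartAt (EuclideanSpace ℝ (Fin m)) n).source) (v : TangentSpace (𝓡 m) y) :
    endCoord J n (extChartAt (𝓡 m) n y) (coordMap n y v) = coordMap n y (J y v) := by
  have hb : y ∈ (trivializationAt (EuclideanSpace ℝ (Fin m)) (TangentSpace (𝓡 m)) n).baseSet := hy
  have h : (extChartAt (𝓡 m) n).symm (extChartAt (𝓡 m) n y) = y :=
    (extChartAt (𝓡 m) n).left_inv (by simpa using hy)
  rw [endCoord, h, ContinuousLinearMap.inCoordinates]
  exact congrArg (fun u ↦ coordMap n y (J y u))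
    (Trivialization.symmL_continuousLinearMapAt (R := ℝ) _ hb v)

end Coordinates

/-! ### Christoffel symbols of the Levi-Civita connection -/

section Christoffel
open Filter Topology

variable {m : ℕ} {N : Type*} [TopologicalSpace N] [ChartedSpace (EuclideanSpace ℝ (Fin m)) N]
  [IsManifold (𝓡 m) ∞ N]

/-- The vector field which has the constant coordinates `u` in the chart at `n`; it vanishes
outside the domain of this chart. -/
noncomputable def coordField (n : N) (u : EuclideanSpace ℝ (Fin m)) (y : N) :
    TangentSpace (𝓡 m) y :=
  (trivializationAt (EuclideanSpace ℝ (Fin m)) (TangentSpace (𝓡 m)) n).symmL ℝ y u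

theorem coordMap_coordField {n y : N} (hy : y ∈ (chartAt (EuclideanSpace ℝ (Fin m)) n).source)
    (u : EuclideanSpace ℝ (Fin m)) : coordMap n y (coordField n u y) = u :=
  Trivialization.continuousLinearMapAt_symmL (R := ℝ) _ hy u

theorem metricCoord_symm (g : SmoothMetric m N) (n : N) (u v : EuclideanSpace ℝ (Fin m)) :
    metricCoord g n (extChartAt (𝓡 m) n n) u v = metricCoord g n (extChartAt (𝓡 m) n n) v u := by
  have hn := mem_chart_source (EuclideanSpace ℝ (Fin m)) n
  have h := g.symm n (coordField n u n) (coordField n v n)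
  rwa [← metricCoord_coordMap g hn, ← metricCoord_coordMap g hn, coordMap_coordField hn,
    coordMap_coordField hn] at h

theorem metricCoord_endCoord {g : SmoothMetric m N} {p q : ℕ}
    {J : ∀ x : N, TangentSpace (𝓡 m) x →L[ℝ] TangentSpace (𝓡 m) x}
    (hJ : IsMetallicRiemannian g p q J) (n : N) (u v : EuclideanSpace ℝ (Fin m)) :
    metricCoord g n (extChartAt (𝓡 m) n n) (endCoord J n (extChartAt (𝓡 m) n n) u) v =
      metricCoord g n (extChartAt (𝓡 m) n n) u (endCoord J n (extChartAt (𝓡 m) n n) v) := by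
  have hn := mem_chart_source (EuclideanSpace ℝ (Fin m)) n
  have h := hJ.compatible n (coordField n u n) (coordField n v n)
  rwa [← metricCoord_coordMap g hn, ← metricCoord_coordMap g hn, ← endCoord_coordMap J hn,
    ← endCoord_coordMap J hn, coordMap_coordField hn, coordMap_coordField hn] at h

omit [IsManifold (𝓡 m) ∞ N] in
theorem eventually_mem_chart_source (n : N) :
    ∀ᶠ y in 𝓝 n, y ∈ (chartAt (EuclideanSpace ℝ (Fin m)) n).source :=
  (chartAt (EuclideanSpace ℝ (Fin m)) n).open_source.mem_nhds (mem_chart_source _ n)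

theorem fieldDifferentiableAt_of_coordMap {Y : ∀ x : N, TangentSpace (𝓡 m) x} {n : N}
    (hY : MDifferentiableAt (𝓡 m) 𝓘(ℝ, EuclideanSpace ℝ (Fin m))
      (fun y ↦ coordMap n y (Y y)) n) : FieldDifferentiableAt Y n := by
  refine (mdifferentiableAt_section (𝓡 m) Y).2 (hY.congr_of_eventuallyEq ?_)
  filter_upwards [(trivializationAt (EuclideanSpace ℝ (Fin m)) (TangentSpace (𝓡 m))
    n).open_baseSet.mem_nhds (FiberBundle.mem_baseSet_trivializationAt' n)] with y hy
  simp only [coordMap, Trivialization.continuousLinearMapAt_apply,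
    Trivialization.linearMapAt_apply, hy, if_true]

theorem coordMap_coordField_eventuallyEq (n : N) (u : EuclideanSpace ℝ (Fin m)) :
    (fun y ↦ coordMap n y (coordField n u y)) =ᶠ[𝓝 n] fun _ ↦ u := by
  filter_upwards [eventually_mem_chart_source (m := m) n] with y hy using coordMap_coordField hy u

theorem fieldDifferentiableAt_coordField (n : N) (u : EuclideanSpace ℝ (Fin m)) :
    FieldDifferentiableAt (coordField n u) n :=
  fieldDifferentiableAt_of_coordMap
    (mdifferentiableAt_const.congr_of_eventuallyEq (coordMap_coordField_eventuallyEq n u))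

omit [IsManifold (𝓡 m) ∞ N] in
theorem mvfderiv_congr {F : Type*} [NormedAddCommGroup F] [NormedSpace ℝ F] {h k : N → F} {n : N}
    (hk : h =ᶠ[𝓝 n] k) (v : TangentSpace (𝓡 m) n) :
    mvfderiv (𝓡 m) h n v = mvfderiv (𝓡 m) k n v :=
  DFunLike.congr_fun (hk.mfderiv_eq (I := 𝓡 m) (I' := 𝓘(ℝ, F))) v

theorem mvfderiv_comp_extChartAt {F : Type*} [NormedAddCommGroup F] [NormedSpace ℝ F]
    {h : EuclideanSpace ℝ (Fin m) → F} {n : N} (hh : DifferentiableAt ℝ h (extChartAt (𝓡 m) n n))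
    (v : TangentSpace (𝓡 m) n) :
    mvfderiv (𝓡 m) (fun y ↦ h (extChartAt (𝓡 m) n y)) n v =
      fderiv ℝ h (extChartAt (𝓡 m) n n) (coordMap n n v) := by
  have h1 := mfderiv_comp n hh.mdifferentiableAt
    (mdifferentiableAt_extChartAt (I := 𝓡 m) (mem_chart_source _ n))
  rw [mfderiv_extChartAt_self, mfderiv_eq_fderiv] at h1
  rw [coordMap_self]
  exact congrArg (fun L ↦ L v) h1

theorem lieBracketWithin_eq_zero_of_eventuallyEq_const {E : Type*} [NormedAddCommGroup E]
    [NormedSpace ℝ E] {V W : E → E} {e u w : E} (hV : V =ᶠ[𝓝 e] fun _ ↦ u)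
    (hW : W =ᶠ[𝓝 e] fun _ ↦ w) (s : Set E) : VectorField.lieBracketWithin ℝ V W s e = 0 := by
  rw [hV.lieBracketWithin_vectorField_eq_nhds hW]
  simp [VectorField.lieBracketWithin]

/-- Coordinate fields commute. -/
theorem mlieBracket_coordField (n : N) (u w : EuclideanSpace ℝ (Fin m)) :
    VectorField.mlieBracket (𝓡 m) (coordField n u) (coordField n w) n = 0 := by
  have key (u : EuclideanSpace ℝ (Fin m)) :
      VectorField.mpullbackWithin 𝓘(ℝ, EuclideanSpace ℝ (Fin m)) (𝓡 m) (extChartAt (𝓡 m) n).symm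
        (coordField n u) (Set.range (𝓡 m)) =ᶠ[𝓝 (extChartAt (𝓡 m) n n)] fun _ ↦ u := by
    filter_upwards [extChartAt_target_mem_nhds n] with e he
    have hs : (extChartAt (𝓡 m) n).symm e ∈ (chartAt (EuclideanSpace ℝ (Fin m)) n).source := by
      simpa using (extChartAt (𝓡 m) n).map_target he
    have hinv := isInvertible_mfderivWithin_extChartAt_symm he
    have h1 : coordField n u ((extChartAt (𝓡 m) n).symm e) =
        mfderivWithin 𝓘(ℝ, EuclideanSpace ℝ (Fin m)) (𝓡 m) (extChartAt (𝓡 m) n).symm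
          (Set.range (𝓡 m)) e u := by
      rw [coordField, TangentBundle.symmL_trivializationAt hs, (extChartAt (𝓡 m) n).right_inv he]
      rfl
    rw [VectorField.mpullbackWithin_apply, h1]
    exact hinv.inverse_apply_self u
  rw [← VectorField.mlieBracketWithin_univ, VectorField.mlieBracketWithin_apply]
  have h0 : VectorField.lieBracketWithin ℝ
      (VectorField.mpullbackWithin 𝓘(ℝ, EuclideanSpace ℝ (Fin m)) (𝓡 m) (extChartAt (𝓡 m) n).symm
        (coordField n u) (Set.range (𝓡 m)))
      (VectorField.mpullbackWithin 𝓘(ℝ, EuclideanSpace ℝ (Fin m)) (𝓡 m) (extChartAt (𝓡 m) n).symm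
        (coordField n w) (Set.range (𝓡 m)))
      ((extChartAt (𝓡 m) n).symm ⁻¹' Set.univ ∩ Set.range (𝓡 m)) (extChartAt (𝓡 m) n n) = 0 :=
    lieBracketWithin_eq_zero_of_eventuallyEq_const (key u) (key w) _
  exact (congrArg _ h0).trans (map_zero _)

/-- The Christoffel symbols of the Levi-Civita connection are symmetric, compatible with the metric
and, when `J` is parallel, with `J`. The three identities follow from testing torsion-freeness, the
product rule for `g` and `∇ J = 0` on coordinate fields. -/
theorem exists_levi_civita_christoffel {g : SmoothMetric m N} {p q : ℕ}
    {J : ∀ x : N, TangentSpace (𝓡 m) x →L[ℝ] TangentSpace (𝓡 m) x}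
    (hJ : IsLocallyMetallicRiemannian g p q J) (n : N) :
    ∃ Γ : EuclideanSpace ℝ (Fin m) →L[ℝ] EuclideanSpace ℝ (Fin m) →L[ℝ]
        EuclideanSpace ℝ (Fin m),
      (∀ u v, Γ u v = Γ v u) ∧
      (∀ v u w, fderiv ℝ (metricCoord g n) (extChartAt (𝓡 m) n n) v u w =
        metricCoord g n (extChartAt (𝓡 m) n n) (Γ u v) w +
          metricCoord g n (extChartAt (𝓡 m) n n) u (Γ w v)) ∧
      ∀ v u, fderiv ℝ (endCoord J n) (extChartAt (𝓡 m) n n) v u +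
          Γ (endCoord J n (extChartAt (𝓡 m) n n) u) v =
        endCoord J n (extChartAt (𝓡 m) n n) (Γ u v) := by
  obtain ⟨hM, nabla, hLC, hpar⟩ := hJ
  obtain ⟨Γ, hΓ⟩ := exists_christoffel nabla n
  have hn := mem_chart_source (EuclideanSpace ℝ (Fin m)) n
  have hext (u v : EuclideanSpace ℝ (Fin m)) :
      coordMap n n (nabla (coordField n u) n (coordField n v n)) = Γ u v := by
    rw [hΓ _ (fieldDifferentiableAt_coordField n u), coordMap_coordField hn,
      coordMap_coordField hn, mvfderiv_congr (coordMap_coordField_eventuallyEq n u),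
      mvfderiv_const]
    exact zero_add _
  refine ⟨Γ, fun u v ↦ ?_, fun v u w ↦ ?_, fun v u ↦ ?_⟩
  · have h := (CovariantDerivative.torsion_eq_zero_iff nabla).1 hLC.torsion_free
      (fieldDifferentiableAt_coordField n u) (fieldDifferentiableAt_coordField n v)
    rw [mlieBracket_coordField, sub_eq_zero] at h
    rw [← hext u v, ← hext v u, h]
  · have h : mvfderiv (𝓡 m) (fun y ↦ g.inner y (coordField n u y) (coordField n w y)) n
          (coordField n v n) =
        metricCoord g n (extChartAt (𝓡 m) n n)
            (coordMap n n (nabla (coordField n u) n (coordField n v n)))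
            (coordMap n n (coordField n w n)) +
          metricCoord g n (extChartAt (𝓡 m) n n) (coordMap n n (coordField n u n))
            (coordMap n n (nabla (coordField n w) n (coordField n v n))) := by
      rw [metricCoord_coordMap g hn, metricCoord_coordMap g hn]
      exact hLC.metric _ _ n (fieldDifferentiableAt_coordField n u)
        (fieldDifferentiableAt_coordField n w) (coordField n v n)
    have hG := differentiableAt_metricCoord g n
    have he : (fun y ↦ g.inner y (coordField n u y) (coordField n w y)) =ᶠ[𝓝 n]
        fun y ↦ metricCoord g n (extChartAt (𝓡 m) n y) u w := by
      filter_upwards [eventually_mem_chart_source (m := m) n] with y hy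
      rw [← metricCoord_coordMap g hy, coordMap_coordField hy, coordMap_coordField hy]
    have hd : HasFDerivAt (fun e ↦ metricCoord g n e u w) _ (extChartAt (𝓡 m) n n) :=
      (hG.hasFDerivAt.clm_apply (hasFDerivAt_const u _)).clm_apply (hasFDerivAt_const w _)
    have h1 := mvfderiv_congr he (coordField n v n)
    rw [mvfderiv_comp_extChartAt (h := fun e ↦ metricCoord g n e u w) hd.differentiableAt,
      hd.fderiv, coordMap_coordField hn] at h1
    rw [hext, hext, coordMap_coordField hn, coordMap_coordField hn] at h
    rw [← h, h1]
    simp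
  · have hE := differentiableAt_endCoord hM n
    have he : (fun y ↦ coordMap n y (J y (coordField n u y))) =ᶠ[𝓝 n]
        fun y ↦ endCoord J n (extChartAt (𝓡 m) n y) u := by
      filter_upwards [eventually_mem_chart_source (m := m) n] with y hy
      rw [← endCoord_coordMap J hy, coordMap_coordField hy]
    have hd : HasFDerivAt (fun e ↦ endCoord J n e u) _ (extChartAt (𝓡 m) n n) :=
      hE.hasFDerivAt.clm_apply (hasFDerivAt_const u _)
    have hf : FieldDifferentiableAt (fun y ↦ J y (coordField n u y)) n := by
      refine fieldDifferentiableAt_of_coordMap (MDifferentiableAt.congr_of_eventuallyEq ?_ he)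
      exact hd.differentiableAt.mdifferentiableAt.comp n
        (mdifferentiableAt_extChartAt (I := 𝓡 m) hn)
    have h := congrArg (coordMap n n)
      (hpar _ n (fieldDifferentiableAt_coordField n u) (coordField n v n))
    rw [hΓ _ hf, mvfderiv_congr he,
      mvfderiv_comp_extChartAt (h := fun e ↦ endCoord J n e u) hd.differentiableAt, hd.fderiv,
      coordMap_coordField hn, ← endCoord_coordMap J hn, ← endCoord_coordMap J hn, hext,
      coordMap_coordField hn] at h
    rw [← h]
    simp

end Christoffel

/-! ### Linear algebra of slant submanifolds -/

section SlantAlgebra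

variable {E : Type*} [NormedAddCommGroup E] [NormedSpace ℝ E] {H : Type*} [TopologicalSpace H]
  {I : ModelWithCorners ℝ E H} {S : Type*} [TopologicalSpace S] [ChartedSpace H S]
  {m : ℕ} {N : Type*} [TopologicalSpace N] [ChartedSpace (EuclideanSpace ℝ (Fin m)) N]
  [IsManifold (𝓡 m) ∞ N]

theorem metric_self_nonneg (g : SmoothMetric m N) (n : N) (u : TangentSpace (𝓡 m) n) :
    0 ≤ g.inner n u u := by
  rcases eq_or_ne u 0 with rfl | h
  · simp
  · exact (g.pos n u h).le

theorem metric_cauchy_schwarz (g : SmoothMetric m N) (n : N) (u w : TangentSpace (𝓡 m) n) :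
    g.inner n u w ^ 2 ≤ g.inner n u u * g.inner n w w := by
  rcases eq_or_ne w 0 with rfl | h
  · simp
  have hw := g.pos n w h
  have h1 := metric_self_nonneg g n (g.inner n w w • u - g.inner n u w • w)
  simp only [map_sub, map_smul, sub_apply, smul_apply, smul_eq_mul, g.symm n w u] at h1
  refine le_of_mul_le_mul_left ?_ hw
  linarith

theorem metric_apply_apply {g : SmoothMetric m N} {p q : ℕ}
    {J : ∀ x : N, TangentSpace (𝓡 m) x →L[ℝ] TangentSpace (𝓡 m) x}
    (hJ : IsMetallicRiemannian g p q J) (n : N) (u w : TangentSpace (𝓡 m) n) :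
    g.inner n (J n u) (J n w) = p * g.inner n (J n u) w + q * g.inner n u w := by
  rw [← hJ.compatible, hJ.sq]
  simp

/-- On a slant submanifold the tangential part `t` of `J u` satisfies `|t|² = cos² θ |J u|²`. For
`u ≠ 0` this is the definition of the angle, whose quotient is not degenerate because `θ` is
neither `0` nor `π / 2`. -/
theorem exists_tangential_part {g : SmoothMetric m N}
    {J : ∀ x : N, TangentSpace (𝓡 m) x →L[ℝ] TangentSpace (𝓡 m) x} {φ : S → N} {θ : ℝ}
    (hθ : θ ∈ Set.Ioo 0 (Real.pi / 2)) (hφ : IsSlantSubmanifold I g J φ θ) (s : S)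
    {u : TangentSpace (𝓡 m) (φ s)} (hu : u ∈ tangentImage I φ s) :
    ∃ t ∈ tangentImage I φ s,
      (∀ w ∈ tangentImage I φ s, g.inner (φ s) (J (φ s) u) w = g.inner (φ s) t w) ∧
        g.inner (φ s) t t = Real.cos θ ^ 2 * g.inner (φ s) (J (φ s) u) (J (φ s) u) := by
  rcases eq_or_ne u 0 with rfl | h0
  · exact ⟨0, Submodule.zero_mem _, by simp, by simp⟩
  obtain ⟨t, ⟨ht, hn⟩, hang⟩ := hφ s u hu h0
  have horth (w) (hw : w ∈ tangentImage I φ s) :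
      g.inner (φ s) (J (φ s) u) w = g.inner (φ s) t w := by
    have := hn w hw
    rwa [map_sub, sub_apply, sub_eq_zero] at this
  refine ⟨t, ht, horth, ?_⟩
  have htt := metric_self_nonneg g (φ s) t
  have hJJ := metric_self_nonneg g (φ s) (J (φ s) u)
  rw [metricAngle, horth t ht] at hang
  set r := g.inner (φ s) t t / (metricNorm g (φ s) (J (φ s) u) * metricNorm g (φ s) t) with hr
  have hr1 : r < 1 := by
    by_contra! h
    rw [Real.arccos_of_one_le h] at hang
    exact hθ.1.ne hang
  have hr0 : 0 < r := Real.arccos_lt_pi_div_two.1 (hang ▸ hθ.2)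
  have hcos : Real.cos θ = r := by
    rw [← hang, Real.cos_arccos (by linarith) hr1.le]
  have hne : metricNorm g (φ s) (J (φ s) u) * metricNorm g (φ s) t ≠ 0 := by
    intro h
    rw [hr, h, div_zero] at hr0
    exact hr0.false
  have h1 : metricNorm g (φ s) (J (φ s) u) ^ 2 = g.inner (φ s) (J (φ s) u) (J (φ s) u) :=
    Real.sq_sqrt hJJ
  have h2 : metricNorm g (φ s) t ^ 2 = g.inner (φ s) t t := Real.sq_sqrt htt
  have h3 : r * metricNorm g (φ s) (J (φ s) u) = metricNorm g (φ s) t := by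
    rw [hr, ← h2]
    field_simp
    obtain ⟨h4, h5⟩ := mul_ne_zero_iff.1 hne
    field_simp
  rw [hcos, ← h1, ← h2, ← h3]
  ring

/-- With `t` the tangential part of `J u`, this is the Cauchy–Schwarz inequality for
`g(t, u) = g(J u, u)`, since `|t|² = cos² θ |J u|²` and `|J u|² = p g(J u, u) + q g(u, u)`. -/
theorem sq_slant_form_le {g : SmoothMetric m N} {p q : ℕ}
    {J : ∀ x : N, TangentSpace (𝓡 m) x →L[ℝ] TangentSpace (𝓡 m) x}
    (hJ : IsMetallicRiemannian g p q J) {φ : S → N} {θ : ℝ}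
    (hθ : θ ∈ Set.Ioo 0 (Real.pi / 2)) (hφ : IsSlantSubmanifold I g J φ θ) (s : S)
    {u : TangentSpace (𝓡 m) (φ s)} (hu : u ∈ tangentImage I φ s) :
    g.inner (φ s) (J (φ s) u) u ^ 2 ≤ Real.cos θ ^ 2 *
      (p * g.inner (φ s) (J (φ s) u) u + q * g.inner (φ s) u u) * g.inner (φ s) u u := by
  obtain ⟨t, ht, htan, hnorm⟩ := exists_tangential_part hθ hφ s hu
  rw [← metric_apply_apply hJ, ← hnorm, htan u hu]
  exact metric_cauchy_schwarz g _ t u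

/-- The tangential part `T` of `J` on a tangent space of a slant submanifold satisfies
`T² = cos² θ (p T + q)`; hence it has an eigenvector, with eigenvalue a root of this quadratic
polynomial. -/
theorem exists_slant_eigenvector {g : SmoothMetric m N} {p q : ℕ}
    {J : ∀ x : N, TangentSpace (𝓡 m) x →L[ℝ] TangentSpace (𝓡 m) x}
    (hJ : IsMetallicRiemannian g p q J) {φ : S → N} {θ : ℝ}
    (hθ : θ ∈ Set.Ioo 0 (Real.pi / 2)) (hφ : IsSlantSubmanifold I g J φ θ) (s : S)
    {v : TangentSpace (𝓡 m) (φ s)} (hv : v ∈ tangentImage I φ s) (hv0 : v ≠ 0) :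
    ∃ l : ℝ, l ^ 2 = Real.cos θ ^ 2 * (p * l + q) ∧ ∃ u ∈ tangentImage I φ s, u ≠ 0 ∧
      ∀ w ∈ tangentImage I φ s, g.inner (φ s) (J (φ s) u) w = l * g.inner (φ s) u w := by
  set V := tangentImage (m := m) I φ s with hV
  set c := Real.cos θ ^ 2 with hc
  have hcp : 0 < c := pow_pos (Real.cos_pos_of_mem_Ioo ⟨by linarith [hθ.1, Real.pi_pos], hθ.2⟩) 2
  have hq : (0 : ℝ) < q := by exact_mod_cast hJ.q_pos
  -- the tangential part is unique
  have huniq {t t'} (ht : t ∈ V) (ht' : t' ∈ V)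
      (h : ∀ w ∈ V, g.inner (φ s) t w = g.inner (φ s) t' w) : t = t' := by
    by_contra hne
    have h1 := g.pos (φ s) (t - t') (sub_ne_zero.2 hne)
    rw [map_sub (g.inner (φ s)) t t', sub_apply, h _ (V.sub_mem ht ht'), sub_self] at h1
    exact h1.false
  obtain ⟨t, ht, htan, hnt⟩ := exists_tangential_part hθ hφ s hv
  obtain ⟨t₁, ht₁, htan₁, -⟩ := exists_tangential_part hθ hφ s ht
  -- polarization of `|T u|² = cos² θ |J u|²`
  have hpol (w) (hw : w ∈ V) : g.inner (φ s) t₁ w =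
      c * (p * g.inner (φ s) t w + q * g.inner (φ s) v w) := by
    obtain ⟨r, hr, hrtan, hnr⟩ := exists_tangential_part hθ hφ s hw
    obtain ⟨a, ha, hatan, hna⟩ := exists_tangential_part hθ hφ s (V.add_mem hv hw)
    have hsum : a = t + r := huniq ha (V.add_mem ht hr) fun w hw ↦ by
      rw [← hatan w hw, map_add, map_add, map_add, add_apply, add_apply, htan w hw, hrtan w hw]
    have h1 : g.inner (φ s) t r = c * g.inner (φ s) (J (φ s) v) (J (φ s) w) := by
      rw [hsum] at hna
      simp only [map_add, add_apply] at hna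
      rw [g.symm _ r t, g.symm _ (J (φ s) w) (J (φ s) v)] at hna
      linarith
    rw [← htan₁ w hw, hJ.compatible, g.symm, hrtan t ht, g.symm, h1, metric_apply_apply hJ,
      htan w hw]
  have ht₁eq : t₁ = (c * p) • t + (c * q) • v :=
    huniq ht₁ (V.add_mem (V.smul_mem _ ht) (V.smul_mem _ hv)) fun w hw ↦ by
      rw [hpol w hw]
      simp
      ring
  -- the roots `l`, `k` of `X² - c p X - c q`
  obtain ⟨l, hl⟩ : ∃ l : ℝ, l ^ 2 = c * (p * l + q) := by
    refine ⟨(c * p + Real.sqrt (c ^ 2 * p ^ 2 + 4 * (c * q))) / 2, ?_⟩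
    have := Real.sq_sqrt (show 0 ≤ c ^ 2 * (p : ℝ) ^ 2 + 4 * (c * q) by positivity)
    linear_combination this / 4
  set k := c * p - l with hk
  have hk2 : k ^ 2 = c * (p * k + q) := by rw [hk]; linear_combination hl
  -- `(T - l) (T - k) = 0`, so either `v` or `(T - k) v` is an eigenvector
  by_cases h : t = k • v
  · exact ⟨k, hk2, v, hv, hv0, fun w hw ↦ by rw [htan w hw, h]; simp⟩
  · refine ⟨l, hl, t - k • v, V.sub_mem ht (V.smul_mem _ hv), sub_ne_zero.2 h, fun w hw ↦ ?_⟩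
    simp only [map_sub, map_smul, sub_apply, smul_apply, smul_eq_mul]
    rw [htan w hw, htan₁ w hw, ht₁eq]
    simp only [map_add, map_smul, add_apply, smul_apply, smul_eq_mul]
    rw [hk]
    linear_combination -g.inner (φ s) v w * hl

end SlantAlgebra

/-! ### Leaves of a warped product -/

section Charts
open Filter Topology

theorem coordMap_mfderiv {P : Type*} [NormedAddCommGroup P] [NormedSpace ℝ P]
    {m : ℕ} {N : Type*} [TopologicalSpace N] [ChartedSpace (EuclideanSpace ℝ (Fin m)) N]
    [IsManifold (𝓡 m) ∞ N] {F : P → N} {a : P} {n : N}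
    (hF : MDifferentiableAt 𝓘(ℝ, P) (𝓡 m) F a)
    (hn : F a ∈ (chartAt (EuclideanSpace ℝ (Fin m)) n).source) (v : P) :
    coordMap n (F a) (mfderiv 𝓘(ℝ, P) (𝓡 m) F a v) =
      fderiv ℝ (fun b ↦ extChartAt (𝓡 m) n (F b)) a v := by
  have h := mfderiv_comp a (mdifferentiableAt_extChartAt (I := 𝓡 m) hn) hF
  rw [mfderiv_eq_fderiv] at h
  rw [coordMap, TangentBundle.continuousLinearMapAt_trivializationAt hn]
  exact (congrArg (fun L ↦ L v) h).symm

variable {n₁ n₂ m : ℕ}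
  {M₁ : Type*} [TopologicalSpace M₁] [ChartedSpace (EuclideanSpace ℝ (Fin n₁)) M₁]
  [IsManifold (𝓡 n₁) ∞ M₁]
  {M₂ : Type*} [TopologicalSpace M₂] [ChartedSpace (EuclideanSpace ℝ (Fin n₂)) M₂]
  [IsManifold (𝓡 n₂) ∞ M₂]
  {N : Type*} [TopologicalSpace N] [ChartedSpace (EuclideanSpace ℝ (Fin m)) N]
  [IsManifold (𝓡 m) ∞ N]

section Leaves

variable {g₁ : SmoothMetric n₁ M₁} {g₂ : SmoothMetric n₂ M₂} {g : SmoothMetric m N} {f : M₁ → ℝ}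
  {φ : M₁ × M₂ → N}

omit [IsManifold (𝓡 n₁) ∞ M₁] [IsManifold (𝓡 n₂) ∞ M₂] [IsManifold (𝓡 m) ∞ N] in
theorem mfderiv_leaf_base (hφ : MDifferentiable ((𝓡 n₁).prod (𝓡 n₂)) (𝓡 m) φ) (x : M₁) (y : M₂)
    (v : TangentSpace (𝓡 n₁) x) :
    mfderiv (𝓡 n₁) (𝓡 m) (fun x ↦ φ (x, y)) x v =
      mfderiv ((𝓡 n₁).prod (𝓡 n₂)) (𝓡 m) φ (x, y) (v, (0 : TangentSpace (𝓡 n₂) y)) := by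
  have h := ((hφ (x, y)).hasMFDerivAt.comp x
    ((hasMFDerivAt_id x).prodMk (hasMFDerivAt_const y x))).mfderiv
  exact congrArg (fun L ↦ L v) h

omit [IsManifold (𝓡 n₁) ∞ M₁] [IsManifold (𝓡 n₂) ∞ M₂] [IsManifold (𝓡 m) ∞ N] in
theorem mfderiv_leaf_fibre (hφ : MDifferentiable ((𝓡 n₁).prod (𝓡 n₂)) (𝓡 m) φ) (x : M₁) (y : M₂)
    (w : TangentSpace (𝓡 n₂) y) :
    mfderiv (𝓡 n₂) (𝓡 m) (fun y ↦ φ (x, y)) y w =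
      mfderiv ((𝓡 n₁).prod (𝓡 n₂)) (𝓡 m) φ (x, y) ((0 : TangentSpace (𝓡 n₁) x), w) := by
  have h := ((hφ (x, y)).hasMFDerivAt.comp y
    ((hasMFDerivAt_const x y).prodMk (hasMFDerivAt_id y))).mfderiv
  exact congrArg (fun L ↦ L w) h

theorem IsWarpedProductSubmanifold.inner_leaf_base_leaf_fibre
    (hφ : IsWarpedProductSubmanifold g₁ g₂ g f φ) (x : M₁) (y : M₂)
    {u w : TangentSpace (𝓡 m) (φ (x, y))}
    (hu : u ∈ tangentImage (𝓡 n₁) (fun x ↦ φ (x, y)) x)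
    (hw : w ∈ tangentImage (𝓡 n₂) (fun y ↦ φ (x, y)) y) : g.inner (φ (x, y)) u w = 0 := by
  obtain ⟨v, rfl⟩ := hu
  obtain ⟨v', rfl⟩ := hw
  have hd := hφ.contMDiff.mdifferentiable (by simp)
  have h := hφ.isometric (x, y) (v, (0 : TangentSpace (𝓡 n₂) y))
    ((0 : TangentSpace (𝓡 n₁) x), v')
  simp only [pullbackMetric, warpedMetric, mfderiv_fst, mfderiv_snd] at h
  change g.inner _ (mfderiv (𝓡 n₁) (𝓡 m) (fun x ↦ φ (x, y)) x v)
    (mfderiv (𝓡 n₂) (𝓡 m) (fun y ↦ φ (x, y)) y v') = 0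
  rw [mfderiv_leaf_base hd, mfderiv_leaf_fibre hd]
  refine h.trans ?_
  change g₁.inner x v 0 + f x ^ 2 * g₂.inner y 0 v' = 0
  simp

theorem IsWarpedProductSubmanifold.inner_leaf_fibre
    (hφ : IsWarpedProductSubmanifold g₁ g₂ g f φ) (x : M₁) (y : M₂)
    (v w : TangentSpace (𝓡 n₂) y) :
    g.inner (φ (x, y)) (mfderiv (𝓡 n₂) (𝓡 m) (fun y ↦ φ (x, y)) y v)
      (mfderiv (𝓡 n₂) (𝓡 m) (fun y ↦ φ (x, y)) y w) = f x ^ 2 * g₂.inner y v w := by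
  have hd := hφ.contMDiff.mdifferentiable (by simp)
  have h := hφ.isometric (x, y) ((0 : TangentSpace (𝓡 n₁) x), v)
    ((0 : TangentSpace (𝓡 n₁) x), w)
  simp only [pullbackMetric, warpedMetric, mfderiv_fst, mfderiv_snd] at h
  rw [mfderiv_leaf_fibre hd, mfderiv_leaf_fibre hd]
  refine h.trans ?_
  change g₁.inner x 0 0 + f x ^ 2 * g₂.inner y v w = _
  simp

end Leaves

/-- The inverse of the product of the charts at `x` and `y`, as a map to `M₁ × M₂`. It is written
with the model space `ℝ^n₁ × ℝ^n₂`, so that derivatives along the factors are those in the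
directions `(v, 0)` and `(0, w)`. -/
noncomputable abbrev prodChartSymm (x : M₁) (y : M₂)
    (a : EuclideanSpace ℝ (Fin n₁) × EuclideanSpace ℝ (Fin n₂)) : M₁ × M₂ :=
  ((extChartAt (𝓡 n₁) x).symm a.1, (extChartAt (𝓡 n₂) y).symm a.2)

omit [IsManifold (𝓡 m) ∞ N] in
theorem mfderiv_comp_prodChartSymm {φ : M₁ × M₂ → N}
    (hφ : MDifferentiable ((𝓡 n₁).prod (𝓡 n₂)) (𝓡 m) φ) {x : M₁} {y : M₂}
    {a : EuclideanSpace ℝ (Fin n₁) × EuclideanSpace ℝ (Fin n₂)}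
    (h₁ : a.1 ∈ (extChartAt (𝓡 n₁) x).target) (h₂ : a.2 ∈ (extChartAt (𝓡 n₂) y).target)
    (v : EuclideanSpace ℝ (Fin n₁) × EuclideanSpace ℝ (Fin n₂)) :
    MDifferentiableAt 𝓘(ℝ, EuclideanSpace ℝ (Fin n₁) × EuclideanSpace ℝ (Fin n₂)) (𝓡 m)
      (fun b ↦ φ (prodChartSymm x y b)) a ∧
    mfderiv 𝓘(ℝ, EuclideanSpace ℝ (Fin n₁) × EuclideanSpace ℝ (Fin n₂)) (𝓡 m)
      (fun b ↦ φ (prodChartSymm x y b)) a v =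
    mfderiv ((𝓡 n₁).prod (𝓡 n₂)) (𝓡 m) φ (prodChartSymm x y a)
      (mfderiv 𝓘(ℝ, EuclideanSpace ℝ (Fin n₁)) (𝓡 n₁) (extChartAt (𝓡 n₁) x).symm a.1 v.1,
        mfderiv 𝓘(ℝ, EuclideanSpace ℝ (Fin n₂)) (𝓡 n₂) (extChartAt (𝓡 n₂) y).symm a.2 v.2) := by
  have e₁ : HasMFDerivAt 𝓘(ℝ, EuclideanSpace ℝ (Fin n₁) × EuclideanSpace ℝ (Fin n₂)) (𝓡 n₁)
      (fun b : EuclideanSpace ℝ (Fin n₁) × EuclideanSpace ℝ (Fin n₂) ↦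
        (extChartAt (𝓡 n₁) x).symm b.1) a _ :=
    (mdifferentiableAt_extChartAt_symm' h₁).hasMFDerivAt.comp a
      (hasFDerivAt_fst (𝕜 := ℝ) (p := a)).hasMFDerivAt
  have e₂ : HasMFDerivAt 𝓘(ℝ, EuclideanSpace ℝ (Fin n₁) × EuclideanSpace ℝ (Fin n₂)) (𝓡 n₂)
      (fun b : EuclideanSpace ℝ (Fin n₁) × EuclideanSpace ℝ (Fin n₂) ↦
        (extChartAt (𝓡 n₂) y).symm b.2) a _ :=
    (mdifferentiableAt_extChartAt_symm' h₂).hasMFDerivAt.comp a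
      (hasFDerivAt_snd (𝕜 := ℝ) (p := a)).hasMFDerivAt
  have e := (hφ (prodChartSymm x y a)).hasMFDerivAt.comp a (e₁.prodMk e₂)
  exact ⟨e.mdifferentiableAt, congrArg (fun L ↦ L v) e.mfderiv⟩

end Charts

/-! ### The immersion in charts -/

section Warping
open Filter Topology

variable {n₁ n₂ m : ℕ}
  {M₁ : Type*} [TopologicalSpace M₁] [ChartedSpace (EuclideanSpace ℝ (Fin n₁)) M₁]
  [IsManifold (𝓡 n₁) ∞ M₁]
  {M₂ : Type*} [TopologicalSpace M₂] [ChartedSpace (EuclideanSpace ℝ (Fin n₂)) M₂]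
  [IsManifold (𝓡 n₂) ∞ M₂]
  {N : Type*} [TopologicalSpace N] [ChartedSpace (EuclideanSpace ℝ (Fin m)) N]
  [IsManifold (𝓡 m) ∞ N]

/-- The map `φ` in the chart at `φ (x, y)` and the product of the charts at `x` and `y`. -/
noncomputable def chartExpr (φ : M₁ × M₂ → N) (x : M₁) (y : M₂)
    (b : EuclideanSpace ℝ (Fin n₁) × EuclideanSpace ℝ (Fin n₂)) : EuclideanSpace ℝ (Fin m) :=
  extChartAt (𝓡 m) (φ (x, y)) (φ (prodChartSymm x y b))

omit [IsManifold (𝓡 m) ∞ N] in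
theorem contDiffAt_chartExpr {φ : M₁ × M₂ → N}
    (hφ : ContMDiff ((𝓡 n₁).prod (𝓡 n₂)) (𝓡 m) ∞ φ) (x : M₁) (y : M₂) :
    ContDiffAt ℝ ∞ (chartExpr (m := m) (n₁ := n₁) (n₂ := n₂) φ x y)
      (extChartAt (𝓡 n₁) x x, extChartAt (𝓡 n₂) y y) := by
  rw [← contMDiffAt_iff_contDiffAt]
  set a : EuclideanSpace ℝ (Fin n₁) × EuclideanSpace ℝ (Fin n₂) :=
    (extChartAt (𝓡 n₁) x x, extChartAt (𝓡 n₂) y y) with ha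
  have h₁ : ContMDiffAt 𝓘(ℝ, EuclideanSpace ℝ (Fin n₁)) (𝓡 n₁) ∞
      (extChartAt (𝓡 n₁) x).symm a.1 :=
    (contMDiffOn_extChartAt_symm (I := 𝓡 n₁) x).contMDiffAt
      (extChartAt_target_mem_nhds (I := 𝓡 n₁) x)
  have h₂ : ContMDiffAt 𝓘(ℝ, EuclideanSpace ℝ (Fin n₂)) (𝓡 n₂) ∞
      (extChartAt (𝓡 n₂) y).symm a.2 :=
    (contMDiffOn_extChartAt_symm (I := 𝓡 n₂) y).contMDiffAt
      (extChartAt_target_mem_nhds (I := 𝓡 n₂) y)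
  have h : ContMDiffAt 𝓘(ℝ, EuclideanSpace ℝ (Fin n₁) × EuclideanSpace ℝ (Fin n₂))
      ((𝓡 n₁).prod (𝓡 n₂)) ∞ (prodChartSymm x y) a :=
    (h₁.comp a contDiffAt_fst.contMDiffAt).prodMk (h₂.comp a contDiffAt_snd.contMDiffAt)
  have hc : prodChartSymm x y a = (x, y) := by simp [prodChartSymm, ha]
  have h' := (hφ (prodChartSymm x y a)).comp a h
  have hN : ContMDiffAt (𝓡 m) 𝓘(ℝ, EuclideanSpace ℝ (Fin m)) ∞ (extChartAt (𝓡 m) (φ (x, y)))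
      (φ (prodChartSymm x y a)) := by rw [hc]; exact contMDiffAt_extChartAt
  exact hN.comp a h'

omit [IsManifold (𝓡 n₁) ∞ M₁] [IsManifold (𝓡 n₂) ∞ M₂] [IsManifold (𝓡 m) ∞ N] in
theorem eventually_chartExpr {φ : M₁ × M₂ → N} (hφ : Continuous φ) (x : M₁) (y : M₂) :
    ∀ᶠ b in 𝓝 (extChartAt (𝓡 n₁) x x, extChartAt (𝓡 n₂) y y),
      b.1 ∈ (extChartAt (𝓡 n₁) x).target ∧ b.2 ∈ (extChartAt (𝓡 n₂) y).target ∧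
        φ (prodChartSymm x y b) ∈ (chartAt (EuclideanSpace ℝ (Fin m)) (φ (x, y))).source := by
  have h₁ : ContinuousAt (extChartAt (𝓡 n₁) x).symm (extChartAt (𝓡 n₁) x x) :=
    continuousAt_extChartAt_symm x
  have h₂ : ContinuousAt (extChartAt (𝓡 n₂) y).symm (extChartAt (𝓡 n₂) y y) :=
    continuousAt_extChartAt_symm y
  have h : ContinuousAt (fun b ↦ φ (prodChartSymm x y b))
      (extChartAt (𝓡 n₁) x x, extChartAt (𝓡 n₂) y y) :=
    hφ.continuousAt.comp (ContinuousAt.prodMk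
      (ContinuousAt.comp (f := Prod.fst) (x := (_, _)) h₁ continuousAt_fst)
      (ContinuousAt.comp (f := Prod.snd) (x := (_, _)) h₂ continuousAt_snd))
  refine ((continuousAt_fst (p := (_, _))).tendsto.eventually
    (extChartAt_target_mem_nhds (I := 𝓡 n₁) x)).and
    (((continuousAt_snd (p := (_, _))).tendsto.eventually
      (extChartAt_target_mem_nhds (I := 𝓡 n₂) y)).and
      (h.tendsto.eventually ?_))
  have := eventually_mem_chart_source (m := m) (φ (x, y))
  simpa [prodChartSymm] using this

/-- The partial derivatives of `chartExpr φ x y` along the base are tangent to the leaves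
`M₁ × {y'}`. -/
theorem coordMap_leaf_base {φ : M₁ × M₂ → N}
    (hφ : MDifferentiable ((𝓡 n₁).prod (𝓡 n₂)) (𝓡 m) φ) {x : M₁} {y : M₂}
    {b : EuclideanSpace ℝ (Fin n₁) × EuclideanSpace ℝ (Fin n₂)}
    (h₁ : b.1 ∈ (extChartAt (𝓡 n₁) x).target) (h₂ : b.2 ∈ (extChartAt (𝓡 n₂) y).target)
    (hb : φ (prodChartSymm x y b) ∈ (chartAt (EuclideanSpace ℝ (Fin m)) (φ (x, y))).source)
    (v : EuclideanSpace ℝ (Fin n₁)) :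
    coordMap (φ (x, y)) (φ (prodChartSymm x y b))
        (mfderiv (𝓡 n₁) (𝓡 m) (fun x' ↦ φ (x', (extChartAt (𝓡 n₂) y).symm b.2))
          ((extChartAt (𝓡 n₁) x).symm b.1)
          (mfderiv 𝓘(ℝ, EuclideanSpace ℝ (Fin n₁)) (𝓡 n₁) (extChartAt (𝓡 n₁) x).symm b.1 v)) =
      fderiv ℝ (chartExpr φ x y) b (v, 0) := by
  obtain ⟨hd, h⟩ := mfderiv_comp_prodChartSymm hφ h₁ h₂ (v, 0)
  have h' := coordMap_mfderiv hd hb (v, 0)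
  refine Eq.trans ?_ h'
  rw [h, mfderiv_leaf_base hφ]
  exact congrArg (coordMap (φ (x, y)) (φ (prodChartSymm x y b)))
    (congrArg (mfderiv ((𝓡 n₁).prod (𝓡 n₂)) (𝓡 m) φ (prodChartSymm x y b))
      (Prod.ext rfl (map_zero _).symm))

/-- The partial derivatives of `chartExpr φ x y` along the fibre are tangent to the leaves
`{x'} × M₂`. -/
theorem coordMap_leaf_fibre {φ : M₁ × M₂ → N}
    (hφ : MDifferentiable ((𝓡 n₁).prod (𝓡 n₂)) (𝓡 m) φ) {x : M₁} {y : M₂}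
    {b : EuclideanSpace ℝ (Fin n₁) × EuclideanSpace ℝ (Fin n₂)}
    (h₁ : b.1 ∈ (extChartAt (𝓡 n₁) x).target) (h₂ : b.2 ∈ (extChartAt (𝓡 n₂) y).target)
    (hb : φ (prodChartSymm x y b) ∈ (chartAt (EuclideanSpace ℝ (Fin m)) (φ (x, y))).source)
    (w : EuclideanSpace ℝ (Fin n₂)) :
    coordMap (φ (x, y)) (φ (prodChartSymm x y b))
        (mfderiv (𝓡 n₂) (𝓡 m) (fun y' ↦ φ ((extChartAt (𝓡 n₁) x).symm b.1, y'))
          ((extChartAt (𝓡 n₂) y).symm b.2)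
          (mfderiv 𝓘(ℝ, EuclideanSpace ℝ (Fin n₂)) (𝓡 n₂) (extChartAt (𝓡 n₂) y).symm b.2 w)) =
      fderiv ℝ (chartExpr φ x y) b (0, w) := by
  obtain ⟨hd, h⟩ := mfderiv_comp_prodChartSymm hφ h₁ h₂ (0, w)
  have h' := coordMap_mfderiv hd hb (0, w)
  refine Eq.trans ?_ h'
  rw [h, mfderiv_leaf_fibre hφ]
  exact congrArg (coordMap (φ (x, y)) (φ (prodChartSymm x y b)))
    (congrArg (mfderiv ((𝓡 n₁).prod (𝓡 n₂)) (𝓡 m) φ (prodChartSymm x y b))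
      (Prod.ext (map_zero _).symm rfl))

theorem mvfderiv_extChartAt_comp_eq {S : Type*} [TopologicalSpace S]
    [ChartedSpace (EuclideanSpace ℝ (Fin n₁)) S] {h : S → N} {s : S}
    (hh : MDifferentiableAt (𝓡 n₁) (𝓡 m) h s) (v : TangentSpace (𝓡 n₁) s) :
    mvfderiv (𝓡 n₁) (fun s' ↦ extChartAt (𝓡 m) (h s) (h s')) s v =
      coordMap (h s) (h s) (mfderiv (𝓡 n₁) (𝓡 m) h s v) := by
  have h1 := mfderiv_comp s (mdifferentiableAt_extChartAt (I := 𝓡 m) (mem_chart_source _ (h s))) hh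
  rw [coordMap, TangentBundle.continuousLinearMapAt_trivializationAt (mem_chart_source _ (h s))]
  exact congrArg (fun L ↦ L v) h1

/-- At the centre of the charts tangent vectors of `M₁` are their own coordinates. -/
theorem coordMap_leaf_base_self {φ : M₁ × M₂ → N}
    (hφ : ContMDiff ((𝓡 n₁).prod (𝓡 n₂)) (𝓡 m) ∞ φ) (x : M₁) (y : M₂)
    (v : EuclideanSpace ℝ (Fin n₁)) :
    coordMap (φ (x, y)) (φ (x, y)) (mfderiv (𝓡 n₁) (𝓡 m) (fun x' ↦ φ (x', y)) x v) =
      fderiv ℝ (chartExpr φ x y) (extChartAt (𝓡 n₁) x x, extChartAt (𝓡 n₂) y y) (v, 0) := by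
  have hd := hφ.mdifferentiable (by simp)
  have hl : MDifferentiableAt (𝓡 n₁) (𝓡 m) (fun x' ↦ φ (x', y)) x :=
    (hd (x, y)).comp x (mdifferentiableAt_id.prodMk mdifferentiableAt_const)
  rw [← mvfderiv_extChartAt_comp_eq hl v]
  have hc := ((contDiffAt_chartExpr hφ x y).differentiableAt (by simp)).hasFDerivAt.comp
    (extChartAt (𝓡 n₁) x x)
    ((hasFDerivAt_id (𝕜 := ℝ) (extChartAt (𝓡 n₁) x x)).prodMk
      (hasFDerivAt_const (extChartAt (𝓡 n₂) y y) _))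
  have he : (fun x' ↦ extChartAt (𝓡 m) (φ (x, y)) (φ (x', y))) =ᶠ[𝓝 x]
      fun x' ↦ chartExpr φ x y (extChartAt (𝓡 n₁) x x', extChartAt (𝓡 n₂) y y) := by
    filter_upwards [extChartAt_source_mem_nhds (I := 𝓡 n₁) x] with x' hx'
    rw [chartExpr, prodChartSymm, (extChartAt (𝓡 n₁) x).left_inv hx', extChartAt_to_inv]
  refine (mvfderiv_congr he v).trans
    ((mvfderiv_comp_extChartAt (h := fun e ↦ chartExpr φ x y (e, extChartAt (𝓡 n₂) y y))
      hc.differentiableAt v).trans ?_)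
  exact (congrArg _ (coordMap_self _ v)).trans (congrArg (fun L ↦ L v) hc.fderiv)

/-- At the centre of the charts tangent vectors of `M₂` are their own coordinates. -/
theorem coordMap_leaf_fibre_self {φ : M₁ × M₂ → N}
    (hφ : ContMDiff ((𝓡 n₁).prod (𝓡 n₂)) (𝓡 m) ∞ φ) (x : M₁) (y : M₂)
    (w : EuclideanSpace ℝ (Fin n₂)) :
    coordMap (φ (x, y)) (φ (x, y)) (mfderiv (𝓡 n₂) (𝓡 m) (fun y' ↦ φ (x, y')) y w) =
      fderiv ℝ (chartExpr φ x y) (extChartAt (𝓡 n₁) x x, extChartAt (𝓡 n₂) y y) (0, w) := by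
  have hd := hφ.mdifferentiable (by simp)
  have hl : MDifferentiableAt (𝓡 n₂) (𝓡 m) (fun y' ↦ φ (x, y')) y :=
    (hd (x, y)).comp y (mdifferentiableAt_const.prodMk mdifferentiableAt_id)
  rw [← mvfderiv_extChartAt_comp_eq hl w]
  have hc := ((contDiffAt_chartExpr hφ x y).differentiableAt (by simp)).hasFDerivAt.comp
    (extChartAt (𝓡 n₂) y y)
    ((hasFDerivAt_const (extChartAt (𝓡 n₁) x x) _).prodMk
      (hasFDerivAt_id (𝕜 := ℝ) (extChartAt (𝓡 n₂) y y)))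
  have he : (fun y' ↦ extChartAt (𝓡 m) (φ (x, y)) (φ (x, y'))) =ᶠ[𝓝 y]
      fun y' ↦ chartExpr φ x y (extChartAt (𝓡 n₁) x x, extChartAt (𝓡 n₂) y y') := by
    filter_upwards [extChartAt_source_mem_nhds (I := 𝓡 n₂) y] with y' hy'
    rw [chartExpr, prodChartSymm, (extChartAt (𝓡 n₂) y).left_inv hy', extChartAt_to_inv]
  refine (mvfderiv_congr he w).trans
    ((mvfderiv_comp_extChartAt (h := fun e ↦ chartExpr φ x y (extChartAt (𝓡 n₁) x x, e))
      hc.differentiableAt w).trans ?_)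
  exact (congrArg _ (coordMap_self _ w)).trans (congrArg (fun L ↦ L w) hc.fderiv)

theorem hasFDerivAt_comp_extChartAt_symm {f : M₁ → ℝ} {x : M₁}
    (hf : MDifferentiableAt (𝓡 n₁) 𝓘(ℝ, ℝ) f x) :
    HasFDerivAt (fun e ↦ f ((extChartAt (𝓡 n₁) x).symm e))
      (mvfderiv (𝓡 n₁) f x : EuclideanSpace ℝ (Fin n₁) →L[ℝ] ℝ) (extChartAt (𝓡 n₁) x x) := by
  have hx := extChartAt_to_inv (I := 𝓡 n₁) x
  have hs := mdifferentiableAt_extChartAt_symm' (mem_extChartAt_target (I := 𝓡 n₁) x)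
  have hd : MDifferentiableAt 𝓘(ℝ, EuclideanSpace ℝ (Fin n₁)) 𝓘(ℝ, ℝ)
      (fun e ↦ f ((extChartAt (𝓡 n₁) x).symm e)) (extChartAt (𝓡 n₁) x x) :=
    MDifferentiableAt.comp_of_eq _ hf hs hx
  refine hd.differentiableAt.hasFDerivAt.congr_fderiv ?_
  ext1 v
  have he : f =ᶠ[𝓝 x] fun x' ↦ f ((extChartAt (𝓡 n₁) x).symm (extChartAt (𝓡 n₁) x x')) := by
    filter_upwards [extChartAt_source_mem_nhds (I := 𝓡 n₁) x] with x' hx'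
    rw [(extChartAt (𝓡 n₁) x).left_inv hx']
  have h := (mvfderiv_congr he v).trans (mvfderiv_comp_extChartAt hd.differentiableAt v)
  exact (h.trans (congrArg _ (coordMap_self x v))).symm

end Warping

/-! ### The derivative of the warping function -/

section Warping
open Filter Topology

variable {n₁ n₂ m : ℕ}
  {M₁ : Type*} [TopologicalSpace M₁] [ChartedSpace (EuclideanSpace ℝ (Fin n₁)) M₁]
  [IsManifold (𝓡 n₁) ∞ M₁]
  {M₂ : Type*} [TopologicalSpace M₂] [ChartedSpace (EuclideanSpace ℝ (Fin n₂)) M₂]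
  [IsManifold (𝓡 n₂) ∞ M₂]
  {N : Type*} [TopologicalSpace N] [ChartedSpace (EuclideanSpace ℝ (Fin m)) N]
  [IsManifold (𝓡 m) ∞ N]

/-- If `J X = X'` on a leaf of the base, then `df(X') = l df(X)`, where `l` is an eigenvalue of the
tangential part of `J` on the fibre. With an eigenvector `u` for `l`, extended to a field `Z` on the
fibre that is constant in the chart, `fderiv_slant_form_eq` says that `X g(J Z, Z) = X' g(Z, Z)`,
`fderiv_eq_smul_of_slant` that `X g(J Z, Z) = l X g(Z, Z)`, and `g(Z, Z)` is a constant multiple of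
`f²` along the base. -/
theorem exists_eigenvalue_mvfderiv_warping (hn₂ : 0 < n₂) {g₁ : SmoothMetric n₁ M₁}
    {g₂ : SmoothMetric n₂ M₂} {g : SmoothMetric m N} {p q : ℕ}
    {J : ∀ x : N, TangentSpace (𝓡 m) x →L[ℝ] TangentSpace (𝓡 m) x}
    (hJ : IsLocallyMetallicRiemannian g p q J)
    {f : M₁ → ℝ} {φ : M₁ × M₂ → N} {θ : ℝ} (hθ : θ ∈ Set.Ioo 0 (Real.pi / 2))
    (hφ : IsWarpedProductSemiSlant g₁ g₂ g J f φ θ) (x : M₁) (y : M₂) :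
    ∃ l : ℝ, l ^ 2 = Real.cos θ ^ 2 * (p * l + q) ∧ ∀ v v' : EuclideanSpace ℝ (Fin n₁),
      J (φ (x, y)) (mfderiv (𝓡 n₁) (𝓡 m) (fun x' ↦ φ (x', y)) x v) =
        mfderiv (𝓡 n₁) (𝓡 m) (fun x' ↦ φ (x', y)) x v' →
      mvfderiv (𝓡 n₁) f x v' = l * mvfderiv (𝓡 n₁) f x v := by
  have hM := hJ.1
  have hd := hφ.contMDiff.mdifferentiable (by simp)
  -- a non-zero eigenvector of the tangential part of `J` on the fibre
  obtain ⟨l, hl, u, hu, hu0, hul⟩ : ∃ l : ℝ, l ^ 2 = Real.cos θ ^ 2 * (p * l + q) ∧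
      ∃ u ∈ tangentImage (m := m) (𝓡 n₂) (fun y' ↦ φ (x, y')) y, u ≠ 0 ∧
        ∀ w ∈ tangentImage (𝓡 n₂) (fun y' ↦ φ (x, y')) y,
          g.inner (φ (x, y)) (J (φ (x, y)) u) w = l * g.inner (φ (x, y)) u w := by
    have : Nonempty (Fin n₂) := ⟨⟨0, hn₂⟩⟩
    obtain ⟨w, hw⟩ := exists_ne (0 : EuclideanSpace ℝ (Fin n₂))
    refine exists_slant_eigenvector hM hθ (hφ.slant_fibre x) y ⟨w, rfl⟩ fun h0 ↦ ?_
    have h := hφ.inner_leaf_fibre x y w w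
    have h0' : mfderiv (𝓡 n₂) (𝓡 m) (fun y' ↦ φ (x, y')) y w = 0 := h0
    rw [h0', map_zero] at h
    exact (mul_pos (pow_pos (hφ.warping_pos x) 2) (g₂.pos y w hw)).ne h
  obtain ⟨(z : EuclideanSpace ℝ (Fin n₂)), hz⟩ := id hu
  refine ⟨l, hl, fun v v' hvv' ↦ ?_⟩
  set a : EuclideanSpace ℝ (Fin n₁) × EuclideanSpace ℝ (Fin n₂) :=
    (extChartAt (𝓡 n₁) x x, extChartAt (𝓡 n₂) y y) with ha
  have hcont := contDiffAt_chartExpr hφ.contMDiff x y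
  obtain ⟨Γ, hΓs, hΓg, hΓJ⟩ := exists_levi_civita_christoffel hJ (φ (x, y))
  have hΦa : chartExpr φ x y a = extChartAt (𝓡 m) (φ (x, y)) (φ (x, y)) := by
    simp [chartExpr, prodChartSymm, ha]
  have hnn : φ (x, y) ∈ (chartAt (EuclideanSpace ℝ (Fin m)) (φ (x, y))).source :=
    mem_chart_source _ (φ (x, y))
  have hG : DifferentiableAt ℝ (metricCoord g (φ (x, y))) (chartExpr φ x y a) := by
    rw [hΦa]; exact differentiableAt_metricCoord g (φ (x, y))
  have hE : DifferentiableAt ℝ (endCoord J (φ (x, y))) (chartExpr φ x y a) := by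
    rw [hΦa]; exact differentiableAt_endCoord hM (φ (x, y))
  have hΦd : DifferentiableAt ℝ (chartExpr φ x y) a := hcont.differentiableAt (by simp)
  have hev := eventually_chartExpr (m := m) (n₁ := n₁) (n₂ := n₂) hφ.contMDiff.continuous x y
  -- near `a`, the partial derivatives of `chartExpr φ x y` are tangent to the leaves
  have hbase (w : EuclideanSpace ℝ (Fin n₁)) {b : EuclideanSpace ℝ (Fin n₁) ×
      EuclideanSpace ℝ (Fin n₂)} (h₁ : b.1 ∈ (extChartAt (𝓡 n₁) x).target)
      (h₂ : b.2 ∈ (extChartAt (𝓡 n₂) y).target)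
      (hb : φ (prodChartSymm x y b) ∈ (chartAt (EuclideanSpace ℝ (Fin m)) (φ (x, y))).source) :
      ∃ t : TangentSpace (𝓡 m) (φ (prodChartSymm x y b)),
        t ∈ tangentImage (𝓡 n₁) (fun x' ↦ φ (x', (prodChartSymm x y b).2))
          (prodChartSymm x y b).1 ∧
          fderiv ℝ (chartExpr φ x y) b (w, 0) = coordMap (φ (x, y)) (φ (prodChartSymm x y b)) t :=
    ⟨_, ⟨_, rfl⟩, (coordMap_leaf_base hd h₁ h₂ hb w).symm⟩
  have hfib (w : EuclideanSpace ℝ (Fin n₂)) {b : EuclideanSpace ℝ (Fin n₁) ×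
      EuclideanSpace ℝ (Fin n₂)} (h₁ : b.1 ∈ (extChartAt (𝓡 n₁) x).target)
      (h₂ : b.2 ∈ (extChartAt (𝓡 n₂) y).target)
      (hb : φ (prodChartSymm x y b) ∈ (chartAt (EuclideanSpace ℝ (Fin m)) (φ (x, y))).source) :
      ∃ t : TangentSpace (𝓡 m) (φ (prodChartSymm x y b)),
        t ∈ tangentImage (𝓡 n₂) (fun y' ↦ φ ((prodChartSymm x y b).1, y'))
          (prodChartSymm x y b).2 ∧
          fderiv ℝ (chartExpr φ x y) b (0, w) = coordMap (φ (x, y)) (φ (prodChartSymm x y b)) t :=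
    ⟨_, ⟨_, rfl⟩, (coordMap_leaf_fibre hd h₁ h₂ hb w).symm⟩
  have hderiv :=
    fderiv_slant_form_eq (x := (v, 0)) (x' := (v', 0)) (z := (0, z))
      (contDiffAt_infty.1 hcont 2) hG hE
      (by rw [hΦa]; exact hΓg) (by rw [hΦa]; exact hΓJ) hΓs
      (fun s t ↦ by rw [hΦa, metricCoord_symm])
      (fun s t ↦ by rw [hΦa, metricCoord_endCoord hM])
      (by
        rw [hΦa, ← coordMap_leaf_base_self hφ.contMDiff, ← coordMap_leaf_base_self hφ.contMDiff,
          endCoord_coordMap J hnn, hvv'])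
      (by
        filter_upwards [hev] with b ⟨h₁, h₂, hb⟩
        obtain ⟨s, hs, es⟩ := hbase v h₁ h₂ hb
        obtain ⟨t, ht, et⟩ := hfib z h₁ h₂ hb
        rw [es, et, chartExpr, endCoord_coordMap J hb, metricCoord_coordMap g hb]
        exact hφ.inner_leaf_base_leaf_fibre _ _ (hφ.invariant_base _ _ _ hs) ht)
      (by
        filter_upwards [hev] with b ⟨h₁, h₂, hb⟩
        obtain ⟨s, hs, es⟩ := hbase v' h₁ h₂ hb
        obtain ⟨t, ht, et⟩ := hfib z h₁ h₂ hb
        rw [es, et, chartExpr, metricCoord_coordMap g hb]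
        exact hφ.inner_leaf_base_leaf_fibre _ _ hs ht)
  -- the two quadratic forms along the image of `φ`, on the coordinate field of the fibre
  have hDd (w : EuclideanSpace ℝ (Fin n₁) × EuclideanSpace ℝ (Fin n₂)) :
      DifferentiableAt ℝ (fun b ↦ fderiv ℝ (chartExpr φ x y) b w) a :=
    ((hcont.fderiv_right (m := 1) (by norm_cast)).differentiableAt (by norm_num)).clm_apply
      (differentiableAt_const w)
  have hJDd : DifferentiableAt ℝ (fun b ↦ endCoord J (φ (x, y)) (chartExpr φ x y b)
      (fderiv ℝ (chartExpr φ x y) b (0, z))) a := (hE.comp a hΦd).clm_apply (hDd _)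
  set S : EuclideanSpace ℝ (Fin n₁) × EuclideanSpace ℝ (Fin n₂) → ℝ := fun b ↦
    metricCoord g (φ (x, y)) (chartExpr φ x y b)
      (endCoord J (φ (x, y)) (chartExpr φ x y b) (fderiv ℝ (chartExpr φ x y) b (0, z)))
      (fderiv ℝ (chartExpr φ x y) b (0, z)) with hS
  set G : EuclideanSpace ℝ (Fin n₁) × EuclideanSpace ℝ (Fin n₂) → ℝ := fun b ↦
    metricCoord g (φ (x, y)) (chartExpr φ x y b) (fderiv ℝ (chartExpr φ x y) b (0, z))
      (fderiv ℝ (chartExpr φ x y) b (0, z)) with hGdef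
  have hSd : DifferentiableAt ℝ S a := differentiableAt_metric_along hG hΦd hJDd (hDd _)
  have hGd : DifferentiableAt ℝ G a := differentiableAt_metric_along hG hΦd (hDd _) (hDd _)
  have hle : ∀ᶠ b in 𝓝 a, S b ^ 2 ≤ Real.cos θ ^ 2 * (p * S b + q * G b) * G b := by
    filter_upwards [hev] with b ⟨h₁, h₂, hb⟩
    obtain ⟨t, ht, et⟩ := hfib z h₁ h₂ hb
    simp only [hS, hGdef]
    rw [et, chartExpr, endCoord_coordMap J hb, metricCoord_coordMap g hb, metricCoord_coordMap g hb]
    exact sq_slant_form_le hM hθ (hφ.slant_fibre _) _ ht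
  have hza : fderiv ℝ (chartExpr φ x y) a (0, z) = coordMap (φ (x, y)) (φ (x, y)) u :=
    (coordMap_leaf_fibre_self hφ.contMDiff x y z).symm.trans (congrArg _ hz)
  have hSa : S a = l * G a := by
    simp only [hS, hGdef]
    rw [hΦa, hza, endCoord_coordMap J hnn, metricCoord_coordMap g hnn, metricCoord_coordMap g hnn,
      hul u hu]
  have hGa : 0 < G a := by
    simp only [hGdef]
    rw [hΦa, hza, metricCoord_coordMap g hnn]
    exact g.pos (φ (x, y)) u hu0
  have hcos : 0 < Real.cos θ :=
    Real.cos_pos_of_mem_Ioo ⟨by linarith [hθ.1, Real.pi_pos], hθ.2⟩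
  have hq : (0 : ℝ) < q := by exact_mod_cast hM.q_pos
  have hfirst := fderiv_eq_smul_of_slant hSd hGd hle hSa hGa hl (by positivity) (v, 0)
  rw [hderiv] at hfirst
  -- along the base, `G` is a constant multiple of `f ^ 2`
  set K : ℝ := g₂.inner ((extChartAt (𝓡 n₂) y).symm a.2)
    (mfderiv 𝓘(ℝ, EuclideanSpace ℝ (Fin n₂)) (𝓡 n₂) (extChartAt (𝓡 n₂) y).symm a.2 z)
    (mfderiv 𝓘(ℝ, EuclideanSpace ℝ (Fin n₂)) (𝓡 n₂) (extChartAt (𝓡 n₂) y).symm a.2 z) with hK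
  have hGf : ∀ᶠ e in 𝓝 a.1, G (e, a.2) = f ((extChartAt (𝓡 n₁) x).symm e) ^ 2 * K := by
    have hev' : ∀ᶠ e in 𝓝 a.1, _ :=
      (Continuous.prodMk_left a.2).continuousAt.tendsto.eventually hev
    filter_upwards [hev'] with e ⟨h₁, h₂, hb⟩
    simp only [hGdef]
    rw [← coordMap_leaf_fibre (b := (e, a.2)) hd h₁ h₂ hb z]
    exact (metricCoord_coordMap g hb _ _).trans (hφ.inner_leaf_fibre _ _ _ _)
  have hfd := hasFDerivAt_comp_extChartAt_symm
    ((hφ.contMDiff_warping.mdifferentiable (by simp)) x)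
  have hGderiv (w : EuclideanSpace ℝ (Fin n₁)) :
      fderiv ℝ G a (w, 0) = 2 * f x * K * mvfderiv (𝓡 n₁) f x w := by
    have h1 : HasFDerivAt (fun e ↦ G (e, a.2)) _ a.1 :=
      HasFDerivAt.comp (g := G) (f := fun e ↦ (e, a.2)) a.1 hGd.hasFDerivAt
        ((hasFDerivAt_id (𝕜 := ℝ) a.1).prodMk (hasFDerivAt_const a.2 a.1))
    have h2 := (((hfd.pow 2).mul_const K).congr_of_eventuallyEq hGf).unique h1
    have h3 := congrArg (fun L ↦ L w) h2
    refine h3.symm.trans ?_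
    change K • ((2 • f ((extChartAt (𝓡 n₁) x).symm (extChartAt (𝓡 n₁) x x)) ^ (2 - 1)) •
      mvfderiv (𝓡 n₁) f x w) = _
    rw [extChartAt_to_inv]
    simp only [smul_eq_mul, nsmul_eq_mul]
    push_cast
    ring
  have hKne : 2 * f x * K ≠ 0 := by
    have h := hGf.self_of_nhds
    have h' : G a = f x ^ 2 * K := h.trans (by rw [ha, extChartAt_to_inv])
    rw [h'] at hGa
    have := (pos_iff_pos_of_mul_pos hGa).1 (pow_pos (hφ.warping_pos x) 2)
    have := hφ.warping_pos x
    positivity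
  rw [hGderiv, hGderiv] at hfirst
  apply mul_left_cancel₀ hKne
  linear_combination hfirst

end Warping

/-! ### Functions with vanishing derivative -/

section LocallyConstant
open Filter Topology

variable {n : ℕ} {M : Type*} [TopologicalSpace M] [ChartedSpace (EuclideanSpace ℝ (Fin n)) M]
  [IsManifold (𝓡 n) ∞ M]

theorem isLocallyConstant_of_mvfderiv_eq_zero {f : M → ℝ}
    (hf : MDifferentiable (𝓡 n) 𝓘(ℝ, ℝ) f) (h : ∀ x, mvfderiv (𝓡 n) f x = 0) :
    IsLocallyConstant f := by
  refine (IsLocallyConstant.iff_eventually_eq f).2 fun x ↦ ?_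
  obtain ⟨r, hr, hball⟩ := Metric.mem_nhds_iff.1 (extChartAt_target_mem_nhds (I := 𝓡 n) x)
  have hd : ∀ e ∈ Metric.ball (extChartAt (𝓡 n) x x) r,
      HasFDerivAt (fun e ↦ f ((extChartAt (𝓡 n) x).symm e))
        (0 : EuclideanSpace ℝ (Fin n) →L[ℝ] ℝ) e := by
    intro e he
    have hs := mdifferentiableAt_extChartAt_symm' (hball he)
    have hd := (hf ((extChartAt (𝓡 n) x).symm e)).hasMFDerivAt.comp e hs.hasMFDerivAt
    have h0 : mfderiv (𝓡 n) 𝓘(ℝ, ℝ) f ((extChartAt (𝓡 n) x).symm e) = 0 := h _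
    rw [h0, ContinuousLinearMap.zero_comp] at hd
    exact hd.hasFDerivAt
  have hev : ∀ᶠ x' in 𝓝 x, extChartAt (𝓡 n) x x' ∈ Metric.ball (extChartAt (𝓡 n) x x) r :=
    (continuousAt_extChartAt x).preimage_mem_nhds (Metric.ball_mem_nhds _ hr)
  filter_upwards [hev, extChartAt_source_mem_nhds (I := 𝓡 n) x] with x' hx' hs
  have hc := (convex_ball (extChartAt (𝓡 n) x x) r).is_const_of_fderivWithin_eq_zero (𝕜 := ℝ)
    (fun e he ↦ (hd e he).differentiableAt.differentiableWithinAt)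
    (fun e he ↦ (hd e he).hasFDerivWithinAt.fderivWithin (Metric.isOpen_ball.uniqueDiffWithinAt he))
    hx' (Metric.mem_ball_self hr)
  simpa only [(extChartAt (𝓡 n) x).left_inv hs, extChartAt_to_inv] using hc

end LocallyConstant

/-! ### Constancy of the warping function -/

/-- With `X' = J X` and `X'' = J X' = p X' + q X`, applying `df(J X) = l df(X)` twice gives
`l² df(X) = (p l + q) df(X)`, whereas `l² = cos² θ (p l + q)` with `cos² θ < 1` and `q > 0`. -/
theorem IsWarpedProductSemiSlant.mvfderiv_warping_eq_zero {n₁ n₂ m : ℕ} (hn₂ : 0 < n₂)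
    {M₁ : Type*} [TopologicalSpace M₁] [ChartedSpace (EuclideanSpace ℝ (Fin n₁)) M₁]
    [IsManifold (𝓡 n₁) ∞ M₁]
    {M₂ : Type*} [TopologicalSpace M₂] [Nonempty M₂]
    [ChartedSpace (EuclideanSpace ℝ (Fin n₂)) M₂] [IsManifold (𝓡 n₂) ∞ M₂]
    {N : Type*} [TopologicalSpace N] [ChartedSpace (EuclideanSpace ℝ (Fin m)) N]
    [IsManifold (𝓡 m) ∞ N] {g₁ : SmoothMetric n₁ M₁} {g₂ : SmoothMetric n₂ M₂}
    {g : SmoothMetric m N} {p q : ℕ}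
    {J : ∀ x : N, TangentSpace (𝓡 m) x →L[ℝ] TangentSpace (𝓡 m) x}
    (hJ : IsLocallyMetallicRiemannian g p q J)
    {f : M₁ → ℝ} {φ : M₁ × M₂ → N} {θ : ℝ} (hθ : θ ∈ Set.Ioo 0 (Real.pi / 2))
    (hφ : IsWarpedProductSemiSlant g₁ g₂ g J f φ θ) (x : M₁) :
    mvfderiv (𝓡 n₁) f x = 0 := by
  obtain ⟨y⟩ := ‹Nonempty M₂›
  obtain ⟨l, hl, hdf⟩ := exists_eigenvalue_mvfderiv_warping hn₂ hJ hθ hφ x y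
  have hq : (0 : ℝ) < q := by exact_mod_cast hJ.1.q_pos
  ext1 v
  obtain ⟨v', hv'⟩ := hφ.invariant_base y x _ ⟨v, rfl⟩
  set L := mfderiv (𝓡 n₁) (𝓡 m) (fun x' ↦ φ (x', y)) x with hL
  have h1 := hdf v v' hv'.symm
  have h2 := hdf v' ((p : ℝ) • v' + (q : ℝ) • v) <| by
    have e : J (φ (x, y)) (L v) = L v' := hv'.symm
    have hsq := hJ.1.sq (φ (x, y)) (L v)
    rw [e] at hsq
    refine hsq.trans ?_
    exact ((map_add L _ _).trans (congrArg₂ _ (map_smul L _ _) (map_smul L _ _))).symm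
  have h3 : mvfderiv (𝓡 n₁) f x ((p : ℝ) • v' + (q : ℝ) • v) =
      p * mvfderiv (𝓡 n₁) f x v' + q * mvfderiv (𝓡 n₁) f x v :=
    (map_add (mvfderiv (𝓡 n₁) f x) _ _).trans (congrArg₂ _ (map_smul _ _ _) (map_smul _ _ _))
  rw [h3, h1] at h2
  -- otherwise `l² = p l + q = cos² θ (p l + q)`, hence `l = 0` and `q = 0`
  by_contra hne
  have hl' : p * l + q = l ^ 2 := by
    apply mul_right_cancel₀ (b := mvfderiv (𝓡 n₁) f x v) hne
    linear_combination h2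
  have hs : 0 < Real.sin θ ^ 2 :=
    pow_pos (Real.sin_pos_of_pos_of_lt_pi hθ.1 (by linarith [hθ.2, Real.pi_pos])) 2
  have hl0 : l ^ 2 = 0 := by
    apply mul_left_cancel₀ hs.ne'
    rw [Real.sin_sq]
    linear_combination hl + Real.cos θ ^ 2 * hl'
  have hl00 : l = 0 := by simpa using hl0
  rw [hl00] at hl'
  linarith

/-- The warping function of a warped product semi-slant submanifold `M_T ×_f M_θ`, with `M_T`
invariant and `M_θ` proper slant, of a locally metallic Riemannian manifold is constant on the
connected components of `M_T`. -/
theorem mainTheorem1 {nT nθ m : ℕ} (hnT : 0 < nT) (hnθ : 0 < nθ)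
    {MT : Type*} [TopologicalSpace MT] [T2Space MT] [SecondCountableTopology MT]
    [ChartedSpace (EuclideanSpace ℝ (Fin nT)) MT] [IsManifold (𝓡 nT) ∞ MT]
    {Mθ : Type*} [TopologicalSpace Mθ] [T2Space Mθ] [SecondCountableTopology Mθ] [Nonempty Mθ]
    [ChartedSpace (EuclideanSpace ℝ (Fin nθ)) Mθ] [IsManifold (𝓡 nθ) ∞ Mθ]
    {N : Type*} [TopologicalSpace N] [T2Space N] [SecondCountableTopology N]
    [ChartedSpace (EuclideanSpace ℝ (Fin m)) N] [IsManifold (𝓡 m) ∞ N]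
    (gT : SmoothMetric nT MT) (gθ : SmoothMetric nθ Mθ) (g : SmoothMetric m N)
    (p q : ℕ) (J : ∀ x : N, TangentSpace (𝓡 m) x →L[ℝ] TangentSpace (𝓡 m) x)
    (hJ : IsLocallyMetallicRiemannian g p q J)
    (f : MT → ℝ) (φ : MT × Mθ → N) (θ : ℝ) (hθ : θ ∈ Set.Ioo 0 (Real.pi / 2))
    (hφ : IsWarpedProductSemiSlant gT gθ g J f φ θ) :
    ∀ x : MT, ∀ x' ∈ connectedComponent x, f x' = f x := by
  intro x x' hx'
  have hf := isLocallyConstant_of_mvfderiv_eq_zero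
    (hφ.contMDiff_warping.mdifferentiable (by simp))
    (hφ.mvfderiv_warping_eq_zero hnθ hJ hθ)
  exact hf.apply_eq_of_isPreconnected isPreconnected_connectedComponent hx' mem_connectedComponent
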